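/- **Setting.** Let $n,m,d,k\ge 1$ be integers. Let $y = F(\bar x)+\varepsilon\in\mathbb R^m$ with $\bar x\in\mathbb R^n$ and $F\in C^1(\mathbb R^n;\mathbb R^m)$, $F(0)=0$, whose Jacobian $J_F$ is Lipschitz on bounded sets. Let $L\in C^1(\mathbb R^m)$ be a loss whose gradient is Lipschitz on bounded sets, with $\min L=0$ and $\operatorname{Argmin}L=\{y\}$. Let $\phi\in C^1(\mathbb R)$, $\phi\not\equiv0$, be such that for some $B>0$, $|\phi'|\le B$ and $\phi'$ is $B$-Lipschitz. Consider the network $$g(u,\theta)=\tfrac1{\sqrt k}V\phi(Wu),\qquad \theta=(W,V)\in\mathbb R^{k\times d}\times\mathbb R^{n\times k},$$ with $\phi$ applied entrywise and both layers trained. Let $J_g(\theta)$ be the Jacobian of $g(u,\cdot)$ at $\theta$; parameters carry the Euclidean norm and matrices the spectral norm. *Random initialization.* $\theta_0=(W(0),V(0))$, where $u$ is uniform on the unit sphere $\mathbb S^{d-1}$; $W(0)$ has iid $\mathcal N(0,1)$ entries and is independent of $u$; $V(0)$ is independent of $(u,W(0))$ and has iid columns with identity covariance and centered entries bounded by $D$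 in absolute value. Put $y(0)=F(g(u,\theta_0))$. *The constant $\sigma_F$.* Let $\Theta$ be a set of parameters (possibly depending on the initialization, e.g. a ball around $\theta_0$) and $$\sigma_F=\inf\Big\{\tfrac{\|J_F(x)^\top z\|}{\|z\|} : x\in\Sigma_\Theta,\ 0\neq z\in\operatorname{ran}J_F(x)\Big\},\qquad \Sigma_\Theta=\{g(u,\theta):\theta\in\Theta\}.$$ Almost surely, $\theta_0\in\Theta$, $J_F(g(u,\theta_0))\ne0$ and $\sigma_F>0$. *Constants.* For $C>0$ put $L_{F,0}=\max_{\|x\|\le C\sqrt{n\log d}}\|J_F(x)\|$, $\ A=C L_{F,0}\sqrt{n\log d}+\sqrt m\,(\|F(\bar x)\|_\infty+\|\varepsilon\|_\infty)$, $\ L_{L,0}=\sup_{\|v\|\le A,\,v\ne y}\frac{\|\nabla L(v)\|}{\|v-y\|}$. *Desingularizing function.* $L$ satisfies the KL inequality on $\{0<L<r_0\}$ with $\psi$: $\psi$ is continuous and strictly increasing on $[0,r_0)$, $C^1$ on $(0,r_0)$, $\psi(0)=0$, and $\psi'(L(v))\,\|\nabla L(v)\|\ge1$ whenever $0<L(v)<r_0$.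 Here $r_0$ is such that the argument of $\psi$ below lies in its domain: $\frac{L_{L,0}}2A^2<r_0$. *Initialization condition.* Let $\sigma_{\min}(J_g(\theta_0))=\min_{\|z\|=1}\|J_g(\theta_0)^\top z\|$, and $$R'=\frac{2}{\sigma_F\,\sigma_{\min}(J_g(\theta_0))}\,\psi(L(y(0))),\qquad R=\frac{\sigma_{\min}(J_g(\theta_0))}{2\operatorname{Lip}_{B(\theta_0,R)}(J_g)},$$ where, precisely, $R\in[0,\infty]$ is the supremum of all $\rho\ge0$ with $2\rho\operatorname{Lip}_{B(\theta_0,\rho)}(J_g)\le\sigma_{\min}(J_g(\theta_0))$ (if $\sigma_{\min}(J_g(\theta_0))>0$, this is the solution of the implicit equation whenever one exists). The initialization condition is: $\sigma_{\min}(J_g(\theta_0))>0$ and $R'<R$. **Theorem.** For every such $\phi$ and every $D$ there are constants $C,C'>0$, depending only on $\phi$ and $D$, such that for all other data as above: if almost surely $$k\ \ge\ C'\,\sigma_F^{-4}\,n\,\psi\Big(\frac{L_{L,0}}{2}\big(C L_{F,0}\sqrt{n\log d}+\sqrt m\,(\|F(\bar x)\|_\infty+\|\varepsilon\|_\infty)\big)^2\Big)^4,$$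 then, with probability at least $1-2n^{-1}-d^{-1}$, $L(y(0))<r_0$ (so that $\psi(L(y(0)))$ is defined) and the initialization condition holds. -/

import Mathlib

open MeasureTheory ProbabilityTheory Set
open scoped NNReal ENNReal

noncomputable section

/-- Euclidean space `ℝⁿ`. -/
abbrev Vec (n : ℕ) : Type := EuclideanSpace ℝ (Fin n)

/-- The parameters `θ = (W, V)` with `W ∈ ℝ^{k × d}` and `V ∈ ℝ^{n × k}`, stacked in one vector
of `ℝ^{k (d + n)}` that carries the Euclidean norm. -/
abbrev Param (k d n : ℕ) : Type := EuclideanSpace ℝ ((Fin k × Fin d) ⊕ (Fin n × Fin k))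

/-- The first layer `W` of `θ = (W, V)`. -/
def Param.W {k d n : ℕ} (θ : Param k d n) : Matrix (Fin k) (Fin d) ℝ :=
  Matrix.of fun j l => θ (Sum.inl (j, l))

/-- The second layer `V` of `θ = (W, V)`. -/
def Param.V {k d n : ℕ} (θ : Param k d n) : Matrix (Fin n) (Fin k) ℝ :=
  Matrix.of fun i j => θ (Sum.inr (i, j))

/-- The parameter `θ = (W, V)` with given layers. -/
def mkParam {k d n : ℕ} (W : Matrix (Fin k) (Fin d) ℝ) (V : Matrix (Fin n) (Fin k) ℝ) :
    Param k d n :=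
  WithLp.toLp 2 (Sum.elim (fun p => W p.1 p.2) (fun p => V p.1 p.2))

/-- The two-layer network `g(u, θ) = V φ(W u) / √k`, with `φ` applied entrywise. -/
def net (φ : ℝ → ℝ) {k d n : ℕ} (u : Vec d) (θ : Param k d n) : Vec n :=
  WithLp.toLp 2
    ((1 / Real.sqrt (k : ℝ)) • (θ.V.mulVec fun j => φ (θ.W.mulVec (WithLp.ofLp u) j)))

/-- The Jacobian of the network with respect to all its parameters (both layers). -/
def netJac (φ : ℝ → ℝ) {k d n : ℕ} (u : Vec d) (θ : Param k d n) : Param k d n →L[ℝ] Vec n :=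
  fderiv ℝ (net φ u) θ

/-- `‖v‖_∞`, the largest absolute value of an entry. -/
def supNorm {m : ℕ} (v : Vec m) : ℝ := ‖(WithLp.ofLp v : Fin m → ℝ)‖

/-- The map is Lipschitz continuous on every bounded set. -/
def LipschitzOnBounded {E G : Type*} [PseudoMetricSpace E] [PseudoMetricSpace G] (f : E → G) :
    Prop :=
  ∀ s : Set E, Bornology.IsBounded s → ∃ K : ℝ≥0, LipschitzOnWith K f s

/-- The assumption on the activation: `φ` is `C¹`, and for some `B > 0` its derivative is bounded
by `B` and `B`-Lipschitz. -/
def SmoothActivation (φ : ℝ → ℝ) : Prop :=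
  ContDiff ℝ 1 φ ∧ ∃ B : ℝ≥0, 0 < B ∧ (∀ x, |deriv φ x| ≤ B) ∧ LipschitzWith B (deriv φ)

/-- `f ∈ KL_ψ(r₀)`: the global Kurdyka-Łojasiewicz inequality with desingularizing function `ψ`
on the sublevel set `[min f < f < min f + r₀]`. Only the values of `ψ` on `[0, r₀)` matter. -/
structure KLInequality {m : ℕ} (f : Vec m → ℝ) (ψ : ℝ → ℝ) (r₀ : ℝ) : Prop where
  smooth : ContDiff ℝ 1 f
  pos : 0 < r₀
  strictMono : StrictMonoOn ψ (Ico 0 r₀)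
  cont : ContinuousOn ψ (Ico 0 r₀)
  contDiff : ContDiffOn ℝ 1 ψ (Ioo 0 r₀)
  zero : ψ 0 = 0
  ineq : ∃ c : ℝ, IsLeast (range f) c ∧
    ∀ z : Vec m, c < f z → f z < c + r₀ → 1 ≤ deriv ψ (f z - c) * ‖gradient f z‖

/-- The uniform probability measure on the unit sphere of `ℝᵈ`. -/
def uniformSphere (d : ℕ) : Measure (Vec d) :=
  ((volume : Measure (Vec d)).toSphere univ)⁻¹ •
    ((volume : Measure (Vec d)).toSphere).map Subtype.val

/-- The random input `u` and initialization `W(0)`, `V(0)`: `u` is uniform on the sphere; `W(0)`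
has iid standard Gaussian entries and is independent of `u`; `V(0)` is independent of
`(u, W(0))`, and has iid columns with centered entries bounded by `D` and identity covariance. -/
structure RandomInit {Ω : Type*} [MeasurableSpace Ω] (μ : Measure Ω) (D : ℝ) {k d n : ℕ}
    (u : Ω → Vec d) (W : Ω → Matrix (Fin k) (Fin d) ℝ) (V : Ω → Matrix (Fin n) (Fin k) ℝ) :
    Prop where
  u_law : HasLaw u (uniformSphere d) μ
  W_law : ∀ j l, HasLaw (fun ω => W ω j l) (gaussianReal 0 1) μ
  W_indep : iIndepFun (fun (p : Fin k × Fin d) ω => W ω p.1 p.2) μ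
  W_indep_u : IndepFun (fun ω (j : Fin k) (l : Fin d) => W ω j l) u μ
  V_indep : IndepFun (fun ω (i : Fin n) (j : Fin k) => V ω i j)
    (fun ω => (u ω, fun (j : Fin k) (l : Fin d) => W ω j l)) μ
  V_col_indep : iIndepFun (fun (j : Fin k) ω (i : Fin n) => V ω i j) μ
  V_col_ident : ∀ j j' : Fin k,
    IdentDistrib (fun ω (i : Fin n) => V ω i j) (fun ω (i : Fin n) => V ω i j') μ μ
  V_bound : ∀ᵐ ω ∂μ, ∀ i j, |V ω i j| ≤ D
  V_centered : ∀ i j, ∫ ω, V ω i j ∂μ = 0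
  V_cov : ∀ i i' j, ∫ ω, V ω i j * V ω i' j ∂μ = if i = i' then 1 else 0

/-- `σ_F = inf ‖J_F(x)ᵀ z‖ / ‖z‖` over `x ∈ Σ_Θ = {g(u, θ) : θ ∈ Θ}` and nonzero
`z ∈ ran J_F(x)`. -/
def sigmaF (φ : ℝ → ℝ) {k d n m : ℕ} (F : Vec n → Vec m) (u : Vec d) (Θ : Set (Param k d n)) :
    ℝ :=
  sInf {r : ℝ | ∃ x ∈ net φ u '' Θ, ∃ z ∈ range (fderiv ℝ F x), z ≠ 0 ∧
    r = ‖(fderiv ℝ F x).adjoint z‖ / ‖z‖}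

/-- `L_{F,0} = max {‖J_F(x)‖ : ‖x‖ ≤ C √(n log d)}`, with the spectral norm. -/
def LF0 (C : ℝ) (d : ℕ) {n m : ℕ} (F : Vec n → Vec m) : ℝ :=
  sSup ((fun x => ‖fderiv ℝ F x‖) ''
    Metric.closedBall (0 : Vec n) (C * Real.sqrt (n * Real.log d)))

/-- The radius `C L_{F,0} √(n log d) + √m (‖F(x̄)‖_∞ + ‖ε‖_∞)`. -/
def misfitRadius (C : ℝ) (d : ℕ) {n m : ℕ} (F : Vec n → Vec m) (xbar : Vec n) (ε : Vec m) : ℝ :=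
  C * LF0 C d F * Real.sqrt (n * Real.log d) +
    Real.sqrt (m : ℝ) * (supNorm (F xbar) + supNorm ε)

/-- `L_{L,0} = sup ‖∇L(v)‖ / ‖v - y‖` over `v ≠ y` in the closed ball of radius `misfitRadius`
about the origin, where `y = F(x̄) + ε`. -/
def LL0 (C : ℝ) (d : ℕ) {n m : ℕ} (F : Vec n → Vec m) (xbar : Vec n) (ε : Vec m)
    (L : Vec m → ℝ) : ℝ :=
  sSup ((fun v => ‖gradient L v‖ / ‖v - (F xbar + ε)‖) ''
    (Metric.closedBall (0 : Vec m) (misfitRadius C d F xbar ε) \ {F xbar + ε}))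

/-- `(L_{L,0} / 2) (C L_{F,0} √(n log d) + √m (‖F(x̄)‖_∞ + ‖ε‖_∞))²`. -/
def lossLevel (C : ℝ) (d : ℕ) {n m : ℕ} (F : Vec n → Vec m) (xbar : Vec n) (ε : Vec m)
    (L : Vec m → ℝ) : ℝ :=
  LL0 C d F xbar ε L / 2 * misfitRadius C d F xbar ε ^ 2

/-- `σ_min(J_g(θ))`, the square root of the smallest eigenvalue of `J_g(θ) J_g(θ)ᵀ`, written as
the minimum of `‖J_g(θ)ᵀ z‖` over unit vectors `z`. -/
def sigmaMinJac (φ : ℝ → ℝ) {k d n : ℕ} (u : Vec d) (θ : Param k d n) : ℝ :=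
  sInf ((fun z => ‖(netJac φ u θ).adjoint z‖) '' Metric.sphere (0 : Vec n) 1)

/-- The best Lipschitz constant of `f` on `s` (a pair of equal points contributes `0`). -/
def lipConst {E G : Type*} [PseudoEMetricSpace E] [PseudoEMetricSpace G] (f : E → G)
    (s : Set E) : ℝ≥0∞ :=
  ⨆ x ∈ s, ⨆ y ∈ s, edist (f x) (f y) / edist x y

/-- The radius `R` with `R = σ_min(J_g(θ₀)) / (2 Lip_{B(θ₀,R)}(J_g))`, taken as the supremum of
all `ρ` with `2 ρ Lip_{B(θ₀,ρ)}(J_g) ≤ σ_min(J_g(θ₀))`. Since `ρ Lip_{B(θ₀,ρ)}(J_g)` increases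
with `ρ`, strictly where it is positive, this is the solution of the implicit equation whenever
there is one and `σ_min(J_g(θ₀)) > 0`; it is also meaningful (possibly infinite) when the Lipschitz
constant jumps over the solution or vanishes. -/
def radiusR (φ : ℝ → ℝ) {k d n : ℕ} (u : Vec d) (θ₀ : Param k d n) : ℝ≥0∞ :=
  ⨆ (ρ : ℝ≥0) (_ : 2 * (ρ : ℝ≥0∞) * lipConst (netJac φ u) (Metric.closedBall θ₀ ρ) ≤
    ENNReal.ofReal (sigmaMinJac φ u θ₀)), (ρ : ℝ≥0∞)

/-- `R' = 2 ψ(L(y(0))) / (σ_F σ_min(J_g(θ₀)))` with `y(0) = F(g(u, θ₀))`. -/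
def radiusR' (φ : ℝ → ℝ) {k d n m : ℕ} (F : Vec n → Vec m) (L : Vec m → ℝ) (ψ : ℝ → ℝ)
    (u : Vec d) (Θ : Set (Param k d n)) (θ₀ : Param k d n) : ℝ :=
  2 / (sigmaF φ F u Θ * sigmaMinJac φ u θ₀) * ψ (L (F (net φ u θ₀)))

/-- The initialization condition `σ_min(J_g(θ₀)) > 0` and `R' < R`. -/
def InitCondition (φ : ℝ → ℝ) {k d n m : ℕ} (F : Vec n → Vec m) (L : Vec m → ℝ) (ψ : ℝ → ℝ)
    (u : Vec d) (Θ : Set (Param k d n)) (θ₀ : Param k d n) : Prop :=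
  0 < sigmaMinJac φ u θ₀ ∧ ENNReal.ofReal (radiusR' φ F L ψ u Θ θ₀) < radiusR φ u θ₀

end

/-! Let `Ψ` be the desingularized loss level, `q = Ψ / σ_F`, `p = E φ(G)²` for a standard Gaussian
`G`, and `s = √(p/2)`. Varying the second layer alone shows that `σ_min(J_g(θ₀))²` is at least the
mean of the `φ(w_j · u)²` (`sqrt_meanSqAct_le_sigmaMinJac`). This mean concentrates around `p > 0`
by Chebyshev, so `σ_min ≥ s` with high probability. The output columns have norm `O(√n)`, hence
`J_g` has Lipschitz constant `O((1 + √n + ρ)/√k)` on the ball of radius `ρ` (`norm_netJac_sub_le`).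
With `ρ = 4q/s` this yields `R ≥ 4q/s` once `√k` exceeds a multiple of `q(1 + √n + q)`, while `R' ≤
2q/s`.

The width hypothesis speaks of `q`, so `√n` has to be absorbed into `q`. A KL function whose only
zero is `y` satisfies `‖v - y‖ ≤ 2ψ(L(v))` (`KLInequality.half_norm_sub_le`). Evaluated at a point
of the ball of radius `A` lying at distance `A` from `y`, where `L` is at most the loss level, it
gives `A ≤ 2Ψ`. Since `A ≥ C L_{F,0} √(n log d)` and `L_{F,0} ≥ σ_F`, `q` is at least of order `√n`
(`exists_ratio_bounds`).

Both `L_{F,0} ≥ σ_F` and the bound on the initial loss rest on `‖g(u, θ₀)‖ ≤ C √(n log d)`. Given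
`(u, W)`, each output coordinate is sub-Gaussian, but the coordinates may depend on each other;
averaging `cosh` bounds the norm nevertheless (`measure_sqrt_mean_sq_ge_le`), at the cost of the
`1/d`. The `2/n` is the Chebyshev failure: `k` is deterministic, so a single good outcome already
forces `k` to exceed a multiple of `n`. -/

/-! ### Error bound from the KL inequality, and quadratic growth -/

/-- A function with negative derivative is strictly smaller just to the right. -/
theorem HasDerivAt.eventually_lt_right {f : ℝ → ℝ} {f' x : ℝ} (h : HasDerivAt f f' x)
    (hf' : f' < 0) : ∀ᶠ t in nhdsWithin (0 : ℝ) (Ioi 0), f (x + t) < f x := by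
  have h1 := h.tendsto_slope_zero_right.eventually (gt_mem_nhds hf')
  filter_upwards [h1, self_mem_nhdsWithin] with t ht ht0
  have ht0' : (0 : ℝ) < t := ht0
  rw [smul_eq_mul] at ht
  have := (mul_neg_iff.1 ht).resolve_right (fun h => absurd h.1 (not_lt.2 (inv_pos.2 ht0').le))
  linarith [this.2]

theorem HasGradientAt.hasDerivAt_line {E : Type*} [NormedAddCommGroup E] [InnerProductSpace ℝ E]
    [CompleteSpace E] {f : E → ℝ} {g x v : E} {t : ℝ} (h : HasGradientAt f g (x + t • v)) :
    HasDerivAt (fun s : ℝ => f (x + s • v)) (inner ℝ g v) t := by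
  have h1 : HasDerivAt (fun s : ℝ => x + s • v) v t := by
    simpa using ((hasDerivAt_id t).smul_const v).const_add x
  exact (h.hasFDerivAt.comp_hasDerivAt t h1).congr_deriv (by simp)

/-- A Kurdyka-Łojasiewicz function with a unique zero as minimizer has an error bound. -/
theorem KLInequality.half_norm_sub_le {m : ℕ} {f : Vec m → ℝ} {ψ : ℝ → ℝ} {r₀ : ℝ}
    (h : KLInequality f ψ r₀) (hmin : IsLeast (range f) 0) {y : Vec m}
    (hy : ∀ v, f v = 0 ↔ v = y) {v : Vec m} (hv : f v < r₀) : ‖v - y‖ / 2 ≤ ψ (f v) := by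
  have hf0 : ∀ w, 0 ≤ f w := fun w => hmin.2 ⟨w, rfl⟩
  have hψ0 : ∀ r ∈ Ico 0 r₀, 0 ≤ ψ r := fun r hr => by
    rw [← h.zero]
    exact h.strictMono.monotoneOn ⟨le_rfl, h.pos⟩ hr hr.1
  obtain ⟨c, hc, hKL⟩ := h.ineq
  obtain rfl : c = 0 := hc.unique hmin
  have hcont : Continuous f := h.smooth.continuous
  -- The sublevel condition keeps `f` in the domain of `ψ`. The radius places `y` on the boundary
  -- sphere, so `f` is positive at interior points.
  set S : Set (Vec m) := Metric.closedBall v ‖v - y‖ ∩ {w | f w ≤ f v} with hS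
  have hScomp : IsCompact S :=
    (isCompact_closedBall _ _).inter_right (isClosed_le hcont continuous_const)
  have hvS : v ∈ S := ⟨Metric.mem_closedBall_self (norm_nonneg _), le_refl (f v)⟩
  have hcon : ContinuousOn (fun w => ψ (f w) + ‖w - v‖ / 2) S := by
    refine ContinuousOn.add (h.cont.comp hcont.continuousOn fun w hw => ⟨hf0 w, ?_⟩) (by fun_prop)
    exact lt_of_le_of_lt hw.2 hv
  obtain ⟨w, hwS, hwmin⟩ := hScomp.exists_isMinOn ⟨v, hvS⟩ hcon
  have hwv : ψ (f w) + ‖w - v‖ / 2 ≤ ψ (f v) := by simpa using hwmin hvS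
  have hwr : f w < r₀ := lt_of_le_of_lt hwS.2 hv
  have hball : ‖w - v‖ ≤ ‖v - y‖ := by simpa [dist_eq_norm] using hwS.1
  have hψw := hψ0 _ ⟨hf0 w, hwr⟩
  -- On the boundary, minimality and `ψ ≥ 0` give the claim at once. An interior minimizer is
  -- refuted by a gradient step that stays in `S`.
  rcases hball.eq_or_lt with heq | hlt
  · linarith
  exfalso
  have hw0 : 0 < f w := by
    refine lt_of_le_of_ne (hf0 w) fun h0 => ?_
    have := (hy w).1 h0.symm
    rw [this, norm_sub_rev] at hlt
    exact lt_irrefl _ hlt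
  set g := gradient f w with hg
  have hkl := hKL w hw0 (by linarith)
  rw [sub_zero] at hkl
  have hgpos : 0 < ‖g‖ := by
    rcases (norm_nonneg g).eq_or_lt with h0 | h0
    · rw [← h0, mul_zero] at hkl; linarith
    · exact h0
  have hgrad : HasGradientAt f g w :=
    (h.smooth.differentiable one_ne_zero w).hasGradientAt
  have hd1 : HasDerivAt (fun t : ℝ => f (w + t • (-g))) (-(‖g‖ ^ 2)) 0 := by
    have := HasGradientAt.hasDerivAt_line (v := -g) (t := 0) (x := w) (by simpa using hgrad)
    simpa [inner_neg_right] using this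
  have hψd : HasDerivAt ψ (deriv ψ (f w)) (f w) :=
    ((h.contDiff.differentiableOn one_ne_zero).differentiableAt
      (Ioo_mem_nhds hw0 hwr)).hasDerivAt
  -- By the KL inequality this derivative is at most `-‖g‖ + ‖g‖ / 2 < 0`; the weight `1/2` on the
  -- distance supplies the strictness.
  have hd2 : HasDerivAt (fun t : ℝ => ψ (f (w + t • (-g))) + t * ‖g‖ / 2)
      (deriv ψ (f w) * (-(‖g‖ ^ 2)) + 1 * ‖g‖ / 2) 0 := by
    refine HasDerivAt.add ?_ (((hasDerivAt_id (0 : ℝ)).mul_const _).div_const _)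
    refine HasDerivAt.comp (h₂ := ψ) (0 : ℝ) ?_ hd1
    simpa using hψd
  have he1 := hd1.eventually_lt_right (by nlinarith)
  have he2 := hd2.eventually_lt_right (by nlinarith)
  have he3 : ∀ᶠ t in nhdsWithin (0 : ℝ) (Ioi 0), ‖w + t • (-g) - v‖ < ‖v - y‖ := by
    have hc : Continuous fun t : ℝ => ‖w + t • (-g) - v‖ := by fun_prop
    exact nhdsWithin_le_nhds (hc.continuousAt.eventually (gt_mem_nhds (by simpa using hlt)))
  obtain ⟨t, h1, h2, h3, ht⟩ :=
    (he1.and (he2.and (he3.and (self_mem_nhdsWithin (a := (0:ℝ)) (s := Ioi 0))))).exists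
  have ht0 : (0 : ℝ) < t := ht
  simp only [zero_add, zero_smul, add_zero, zero_mul, zero_div] at h1 h2
  have hmem : w + t • (-g) ∈ S := by
    refine ⟨?_, h1.le.trans hwS.2⟩
    rw [Metric.mem_closedBall, dist_eq_norm]
    exact h3.le
  have h4 : ψ (f w) + ‖w - v‖ / 2 ≤ ψ (f (w + t • (-g))) + ‖w + t • (-g) - v‖ / 2 := hwmin hmem
  have h5 : ‖w + t • (-g) - v‖ ≤ ‖w - v‖ + t * ‖g‖ := by
    have : w + t • (-g) - v = (w - v) + t • (-g) := by abel
    rw [this]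
    refine (norm_add_le _ _).trans ?_
    rw [norm_smul, norm_neg, Real.norm_of_nonneg ht0.le]
  linarith

/-- A bound on the gradient that is linear in the distance to a zero gives a quadratic bound. -/
theorem le_half_mul_sq_of_norm_gradient_le {E : Type*} [NormedAddCommGroup E]
    [InnerProductSpace ℝ E] [CompleteSpace E] {f : E → ℝ} (hf : Differentiable ℝ f) {s : Set E}
    (hs : Convex ℝ s) {K : ℝ} {y v : E} (hy : y ∈ s) (hv : v ∈ s) (hfy : f y = 0)
    (hK : ∀ w ∈ s, ‖gradient f w‖ ≤ K * ‖w - y‖) : f v ≤ K / 2 * ‖v - y‖ ^ 2 := by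
  have hd : ∀ t : ℝ, HasDerivAt (fun t : ℝ => f (y + t • (v - y)) - K / 2 * t ^ 2 * ‖v - y‖ ^ 2)
      (inner ℝ (gradient f (y + t • (v - y))) (v - y) - K / 2 * (2 * t) * ‖v - y‖ ^ 2) t := by
    intro t
    refine HasDerivAt.sub (HasGradientAt.hasDerivAt_line (hf _).hasGradientAt) ?_
    have := (hasDerivAt_pow 2 t).const_mul (K / 2)
    simpa using this.mul_const (‖v - y‖ ^ 2)
  have hanti := antitoneOn_of_deriv_nonpos (convex_Icc (0 : ℝ) 1)
    (fun t _ => (hd t).continuousAt.continuousWithinAt)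
    (fun t _ => (hd t).differentiableAt.differentiableWithinAt) (by
      intro t ht
      rw [interior_Icc] at ht
      rw [(hd t).deriv]
      have hmem : y + t • (v - y) ∈ s := hs.add_smul_sub_mem hy hv ⟨ht.1.le, ht.2.le⟩
      have h1 := hK _ hmem
      rw [add_sub_cancel_left, norm_smul, Real.norm_of_nonneg ht.1.le] at h1
      have h2 := real_inner_le_norm (gradient f (y + t • (v - y))) (v - y)
      nlinarith [norm_nonneg (v - y)])
  have := hanti (left_mem_Icc.2 zero_le_one) (right_mem_Icc.2 zero_le_one) zero_le_one
  simp [hfy] at this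
  linarith

theorem norm_le_sqrt_mul_supNorm {m : ℕ} (v : Vec m) : ‖v‖ ≤ √(m : ℝ) * supNorm v := by
  have h0 : 0 ≤ supNorm v := norm_nonneg _
  rw [EuclideanSpace.norm_eq]
  refine Real.sqrt_le_iff.2 ⟨by positivity, ?_⟩
  rw [mul_pow, Real.sq_sqrt (Nat.cast_nonneg m)]
  calc ∑ i, ‖v i‖ ^ 2 ≤ ∑ _i : Fin m, supNorm v ^ 2 := by
        refine Finset.sum_le_sum fun i _ => ?_
        have : ‖v i‖ ≤ supNorm v := norm_le_pi_norm (WithLp.ofLp v) i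
        gcongr
    _ = _ := by simp

/-! ### Bounds on the data: target, loss level and `σ_F` -/

section Data

variable {n m d : ℕ} {C : ℝ} {F : Vec n → Vec m} {xbar : Vec n} {ε : Vec m} {L : Vec m → ℝ}

theorem norm_fderiv_le_LF0 (hF : ContDiff ℝ 1 F) {x : Vec n} (hx : ‖x‖ ≤ C * √(n * Real.log d)) :
    ‖fderiv ℝ F x‖ ≤ LF0 C d F := by
  have hc : Continuous fun x => ‖fderiv ℝ F x‖ := (hF.continuous_fderiv one_ne_zero).norm
  exact le_csSup ((isCompact_closedBall _ _).image hc).bddAbove ⟨x, by simpa using hx, rfl⟩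

theorem norm_le_LF0_mul (hF : ContDiff ℝ 1 F) (hF0 : F 0 = 0) {x : Vec n}
    (hx : ‖x‖ ≤ C * √(n * Real.log d)) : ‖F x‖ ≤ LF0 C d F * ‖x‖ := by
  have h := Convex.norm_image_sub_le_of_norm_fderiv_le (𝕜 := ℝ) (f := F) (C := LF0 C d F)
    (s := Metric.closedBall (0 : Vec n) (C * √(n * Real.log d))) (x := 0) (y := x)
    (fun z _ => hF.differentiable one_ne_zero z)
    (fun z hz => norm_fderiv_le_LF0 hF (by simpa using hz)) (convex_closedBall _ _)
    (by simpa using (norm_nonneg x).trans hx) (by simpa using hx)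
  simpa [hF0] using h

theorem norm_target_le : ‖F xbar + ε‖ ≤ √(m : ℝ) * (supNorm (F xbar) + supNorm ε) := by
  rw [mul_add]
  exact (norm_add_le _ _).trans
    (add_le_add (norm_le_sqrt_mul_supNorm _) (norm_le_sqrt_mul_supNorm _))

/-- The gradient vanishes at the minimizer and is Lipschitz on the ball. The quotients are therefore
bounded, so the supremum is a genuine one and not the default `0`. -/
theorem norm_gradient_le_LL0 (hL' : LipschitzOnBounded (gradient L))
    (hmin : IsLeast (range L) 0) (hzero : ∀ v, L v = 0 ↔ v = F xbar + ε) {v : Vec m}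
    (hv : ‖v‖ ≤ misfitRadius C d F xbar ε) (hy : ‖F xbar + ε‖ ≤ misfitRadius C d F xbar ε) :
    ‖gradient L v‖ ≤ LL0 C d F xbar ε L * ‖v - (F xbar + ε)‖ := by
  have hgy : gradient L (F xbar + ε) = 0 := by
    have hloc : IsLocalMin L (F xbar + ε) := Filter.Eventually.of_forall fun w => by
      rw [(hzero _).2 rfl]
      exact hmin.2 ⟨w, rfl⟩
    simp [gradient, hloc.fderiv_eq_zero]
  obtain ⟨K, hK⟩ := hL' _ (Metric.isBounded_closedBall (x := (0 : Vec m))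
    (r := misfitRadius C d F xbar ε))
  have hK' : ∀ w : Vec m, ‖w‖ ≤ misfitRadius C d F xbar ε →
      ‖gradient L w‖ ≤ K * ‖w - (F xbar + ε)‖ := fun w hw => by
    have := hK.norm_sub_le (x := w) (y := F xbar + ε) (by simpa using hw) (by simpa using hy)
    rwa [hgy, sub_zero] at this
  rcases eq_or_ne v (F xbar + ε) with rfl | hne
  · simp [hgy]
  have hpos : 0 < ‖v - (F xbar + ε)‖ := norm_pos_iff.2 (sub_ne_zero.2 hne)
  rw [← div_le_iff₀ hpos]
  refine le_csSup ⟨K, ?_⟩ ⟨v, ⟨by simpa using hv, by simpa using hne⟩, rfl⟩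
  rintro _ ⟨w, ⟨hw, hwne⟩, rfl⟩
  have hwpos : 0 < ‖w - (F xbar + ε)‖ := norm_pos_iff.2 (sub_ne_zero.2 (by simpa using hwne))
  exact (div_le_iff₀ hwpos).2 (hK' w (by simpa using hw))

theorem le_LL0_mul_sq (hL : ContDiff ℝ 1 L) (hL' : LipschitzOnBounded (gradient L))
    (hmin : IsLeast (range L) 0) (hzero : ∀ v, L v = 0 ↔ v = F xbar + ε) {v : Vec m}
    (hv : ‖v‖ ≤ misfitRadius C d F xbar ε) (hy : ‖F xbar + ε‖ ≤ misfitRadius C d F xbar ε) :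
    L v ≤ LL0 C d F xbar ε L / 2 * ‖v - (F xbar + ε)‖ ^ 2 :=
  le_half_mul_sq_of_norm_gradient_le (hL.differentiable one_ne_zero)
    (convex_closedBall (0 : Vec m) (misfitRadius C d F xbar ε)) (by simpa using hy)
    (by simpa using hv) ((hzero _).2 rfl)
    fun w hw => norm_gradient_le_LL0 hL' hmin hzero (by simpa using hw) hy

theorem LL0_nonneg : 0 ≤ LL0 C d F xbar ε L :=
  Real.sSup_nonneg (by rintro _ ⟨v, _, rfl⟩; positivity)

theorem LF0_nonneg : 0 ≤ LF0 C d F :=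
  Real.sSup_nonneg (by rintro _ ⟨v, _, rfl⟩; positivity)

theorem norm_target_le_misfitRadius (hC : 0 ≤ C) :
    ‖F xbar + ε‖ ≤ misfitRadius C d F xbar ε := by
  have h1 : ‖F xbar + ε‖ ≤ _ := norm_target_le
  have h2 : 0 ≤ C * LF0 C d F * √(n * Real.log d) := by
    have : 0 ≤ LF0 C d F := LF0_nonneg
    positivity
  unfold misfitRadius
  linarith

/-- The loss level dominates the misfit radius through the desingularizing function. -/
theorem misfitRadius_le_two_mul (hm : 0 < m) (hC : 0 ≤ C) (hL : ContDiff ℝ 1 L)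
    (hL' : LipschitzOnBounded (gradient L)) (hmin : IsLeast (range L) 0)
    (hzero : ∀ v, L v = 0 ↔ v = F xbar + ε) {ψ : ℝ → ℝ} {r₀ : ℝ} (hKL : KLInequality L ψ r₀)
    (hr : lossLevel C d F xbar ε L < r₀) :
    misfitRadius C d F xbar ε ≤ 2 * ψ (lossLevel C d F xbar ε L) := by
  set A := misfitRadius C d F xbar ε with hA
  set y := F xbar + ε with hyd
  have hy : ‖y‖ ≤ A := norm_target_le_misfitRadius hC
  have hA0 : 0 ≤ A := (norm_nonneg _).trans hy
  -- Going from `y` a distance `A` through the origin ends at norm `A - ‖y‖ ≤ A`. For `y = 0` any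
  -- vector of norm `A` works, and one exists because `m > 0`.
  obtain ⟨v, hvA, hvy⟩ : ∃ v : Vec m, ‖v‖ ≤ A ∧ ‖v - y‖ = A := by
    rcases eq_or_ne y 0 with h0 | h0
    · have : Nontrivial (Vec m) := by
        have : Nonempty (Fin m) := ⟨⟨0, hm⟩⟩
        infer_instance
      obtain ⟨v, hv⟩ := exists_norm_eq (Vec m) hA0
      exact ⟨v, hv.le, by rw [h0, sub_zero, hv]⟩
    · have hpos : 0 < ‖y‖ := norm_pos_iff.2 h0
      refine ⟨y - (A / ‖y‖) • y, ?_, ?_⟩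
      · have : y - (A / ‖y‖) • y = (1 - A / ‖y‖) • y := by rw [sub_smul, one_smul]
        rw [this, norm_smul, Real.norm_eq_abs]
        have h1 : 1 ≤ A / ‖y‖ := (one_le_div hpos).2 hy
        rw [abs_of_nonpos (by linarith)]
        have : A / ‖y‖ * ‖y‖ = A := div_mul_cancel₀ _ hpos.ne'
        linarith
      · rw [sub_sub_cancel_left, norm_neg, norm_smul, Real.norm_of_nonneg (by positivity),
          div_mul_cancel₀ _ hpos.ne']
  have hLv : L v ≤ lossLevel C d F xbar ε L := by
    have := le_LL0_mul_sq hL hL' hmin hzero hvA hy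
    rwa [hvy] at this
  have h1 := hKL.half_norm_sub_le hmin hzero (hLv.trans_lt hr)
  have h0 : 0 ≤ L v := hmin.2 ⟨v, rfl⟩
  have h2 := hKL.strictMono.monotoneOn ⟨h0, hLv.trans_lt hr⟩ ⟨h0.trans hLv, hr⟩ hLv
  rw [hvy] at h1
  linarith

/-- The initial loss is at most the loss level when the network output is not too large. -/
theorem loss_le_lossLevel (hC : 0 ≤ C) (hF : ContDiff ℝ 1 F) (hF0 : F 0 = 0)
    (hL : ContDiff ℝ 1 L) (hL' : LipschitzOnBounded (gradient L)) (hmin : IsLeast (range L) 0)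
    (hzero : ∀ v, L v = 0 ↔ v = F xbar + ε) {x : Vec n} (hx : ‖x‖ ≤ C * √(n * Real.log d)) :
    L (F x) ≤ lossLevel C d F xbar ε L := by
  have hLF : 0 ≤ LF0 C d F := LF0_nonneg
  have h1 : ‖F x‖ ≤ C * LF0 C d F * √(n * Real.log d) := by
    refine (norm_le_LF0_mul hF hF0 hx).trans ?_
    nlinarith
  have h2 : ‖F xbar + ε‖ ≤ √(m : ℝ) * (supNorm (F xbar) + supNorm ε) := norm_target_le
  have hFx : ‖F x‖ ≤ misfitRadius C d F xbar ε := by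
    unfold misfitRadius
    linarith [(norm_nonneg _).trans h2]
  refine (le_LL0_mul_sq hL hL' hmin hzero hFx (norm_target_le_misfitRadius hC)).trans ?_
  have h3 : ‖F x - (F xbar + ε)‖ ≤ misfitRadius C d F xbar ε := by
    refine (norm_sub_le _ _).trans ?_
    unfold misfitRadius
    linarith
  have : 0 ≤ LL0 C d F xbar ε L := LL0_nonneg
  unfold lossLevel
  gcongr

end Data

/-- Any nonzero vector in the range of `J_F` at the initial output competes in the infimum, and an
operator and its adjoint have equal norms. -/
theorem sigmaF_le_norm_fderiv {φ : ℝ → ℝ} {k d n m : ℕ} {F : Vec n → Vec m} {u : Vec d}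
    {Θ : Set (Param k d n)} {θ : Param k d n} (hθ : θ ∈ Θ)
    (hF : fderiv ℝ F (net φ u θ) ≠ 0) : sigmaF φ F u Θ ≤ ‖fderiv ℝ F (net φ u θ)‖ := by
  obtain ⟨z, hz⟩ : ∃ z, fderiv ℝ F (net φ u θ) z ≠ 0 := by
    by_contra! h
    exact hF (ContinuousLinearMap.ext h)
  have hle : sigmaF φ F u Θ ≤ ‖(fderiv ℝ F (net φ u θ)).adjoint (fderiv ℝ F (net φ u θ) z)‖ /
      ‖fderiv ℝ F (net φ u θ) z‖ := by
    refine csInf_le ⟨0, ?_⟩ ⟨_, ⟨θ, hθ, rfl⟩, _, ⟨z, rfl⟩, hz, rfl⟩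
    rintro _ ⟨x, _, w, _, _, rfl⟩
    positivity
  refine hle.trans ?_
  · rw [div_le_iff₀ (norm_pos_iff.2 hz), ← LinearIsometryEquiv.norm_map
      ContinuousLinearMap.adjoint (fderiv ℝ F (net φ u θ))]
    exact ContinuousLinearMap.le_opNorm _ _

/-! ### The network: Jacobian, its singular values and its Lipschitz constant -/

noncomputable section

section Network

variable {k d n : ℕ}

/-- The preactivation `w_j · u` of the `j`-th hidden unit, as a functional of the parameters. -/
def preact (u : Vec d) (j : Fin k) : Param k d n →L[ℝ] ℝ :=
  ∑ l, u l • EuclideanSpace.proj (Sum.inl (j, l))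

/-- The `j`-th column of the second layer, as a linear map of the parameters. -/
def outCol (j : Fin k) : Param k d n →L[ℝ] Vec n :=
  LinearMap.toContinuousLinearMap
    { toFun := fun θ => WithLp.toLp 2 fun i => θ (Sum.inr (i, j))
      map_add' := fun _ _ => rfl
      map_smul' := fun _ _ => rfl }

theorem preact_apply (u : Vec d) (j : Fin k) (θ : Param k d n) :
    preact u j θ = ∑ l, θ (Sum.inl (j, l)) * u l := by
  simp [preact, mul_comm]

theorem outCol_apply (j : Fin k) (θ : Param k d n) (i : Fin n) :
    outCol j θ i = θ (Sum.inr (i, j)) := rfl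

theorem net_eq_sum (φ : ℝ → ℝ) (u : Vec d) (θ : Param k d n) :
    net φ u θ = (1 / √(k : ℝ)) • ∑ j, φ (preact u j θ) • outCol j θ := by
  ext i
  simp [net, Matrix.mulVec, dotProduct, Param.V, Param.W, preact_apply, outCol_apply, mul_comm]

/-- The derivative of the network. -/
theorem hasFDerivAt_net {φ : ℝ → ℝ} (hφ : ContDiff ℝ 1 φ) (u : Vec d) (θ : Param k d n) :
    HasFDerivAt (net φ u) ((1 / √(k : ℝ)) • ∑ j, (φ (preact u j θ) • outCol j +
      (deriv φ (preact u j θ) • preact u j).smulRight (outCol j θ))) θ := by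
  have : net φ u = fun θ : Param k d n =>
      (1 / √(k : ℝ)) • ∑ j, φ (preact u j θ) • outCol j θ := funext (net_eq_sum φ u)
  rw [this]
  have h : ∀ j : Fin k, HasFDerivAt (fun θ : Param k d n => φ (preact u j θ) • outCol j θ)
      (φ (preact u j θ) • outCol j +
        (deriv φ (preact u j θ) • preact u j).smulRight (outCol j θ)) θ := fun j => by
    have h1 : HasFDerivAt (fun θ => φ (preact u j θ)) (deriv φ (preact u j θ) • preact u j) θ :=
      (hφ.differentiable one_ne_zero _).hasDerivAt.comp_hasFDerivAt θ
        (preact u j : Param k d n →L[ℝ] ℝ).hasFDerivAt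
    exact h1.smul (outCol j : Param k d n →L[ℝ] Vec n).hasFDerivAt
  exact (HasFDerivAt.fun_sum (u := Finset.univ) fun j _ => h j).fun_const_smul _

theorem netJac_apply {φ : ℝ → ℝ} (hφ : ContDiff ℝ 1 φ) (u : Vec d) (θ η : Param k d n) :
    netJac φ u θ η = (1 / √(k : ℝ)) • ∑ j, (φ (preact u j θ) • outCol j η +
      (deriv φ (preact u j θ) * preact u j η) • outCol j θ) := by
  rw [netJac, (hasFDerivAt_net hφ u θ).fderiv]
  simp

/-- The layers occupy orthogonal blocks. Since `u` is a unit vector, Cauchy-Schwarz bounds each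
preactivation by the norm of its row of `W`. -/
theorem sum_sq_add_sum_sq_le {u : Vec d} (hu : ‖u‖ = 1) (θ : Param k d n) :
    ∑ j, preact u j θ ^ 2 + ∑ j, ‖outCol j θ‖ ^ 2 ≤ ‖θ‖ ^ 2 := by
  rw [EuclideanSpace.norm_sq_eq, Fintype.sum_sum_type, Fintype.sum_prod_type,
    Fintype.sum_prod_type_right]
  refine add_le_add (Finset.sum_le_sum fun j _ => ?_) (Finset.sum_le_sum fun j _ => ?_)
  · rw [preact_apply]
    refine (Finset.sum_mul_sq_le_sq_mul_sq _ _ _).trans ?_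
    have : ∑ l, u l ^ 2 = 1 := by
      have := EuclideanSpace.norm_sq_eq u
      rw [hu] at this
      simpa using this.symm
    rw [this, mul_one]
    simp
  · rw [EuclideanSpace.norm_sq_eq]
    simp [outCol_apply]

theorem sum_preact_sq_le {u : Vec d} (hu : ‖u‖ = 1) (θ : Param k d n) :
    ∑ j, preact u j θ ^ 2 ≤ ‖θ‖ ^ 2 :=
  (le_add_of_nonneg_right (by positivity)).trans (sum_sq_add_sum_sq_le hu θ)

theorem sum_norm_outCol_sq_le {u : Vec d} (hu : ‖u‖ = 1) (θ : Param k d n) :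
    ∑ j, ‖outCol j θ‖ ^ 2 ≤ ‖θ‖ ^ 2 :=
  (le_add_of_nonneg_left (by positivity)).trans (sum_sq_add_sum_sq_le hu θ)

theorem norm_outCol_le {u : Vec d} (hu : ‖u‖ = 1) (j : Fin k) (θ : Param k d n) :
    ‖outCol j θ‖ ≤ ‖θ‖ := by
  refine (sq_le_sq₀ (norm_nonneg _) (norm_nonneg _)).1 ?_
  exact (Finset.single_le_sum (f := fun j => ‖outCol j θ‖ ^ 2) (fun _ _ => by positivity)
    (Finset.mem_univ j)).trans (sum_norm_outCol_sq_le hu θ)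

/-- Cauchy-Schwarz for sums of vectors. -/
theorem norm_sum_smul_le {ι E : Type*} [NormedAddCommGroup E] [NormedSpace ℝ E] (s : Finset ι)
    (a : ι → ℝ) (v : ι → E) {α β : ℝ} (hα : 0 ≤ α) (hβ : 0 ≤ β) (ha : ∑ i ∈ s, a i ^ 2 ≤ α ^ 2)
    (hv : ∑ i ∈ s, ‖v i‖ ^ 2 ≤ β ^ 2) : ‖∑ i ∈ s, a i • v i‖ ≤ α * β := by
  calc ‖∑ i ∈ s, a i • v i‖ ≤ ∑ i ∈ s, |a i| * ‖v i‖ :=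
        norm_sum_le_of_le _ fun i _ => by rw [norm_smul, Real.norm_eq_abs]
    _ ≤ √(∑ i ∈ s, |a i| ^ 2) * √(∑ i ∈ s, ‖v i‖ ^ 2) := Real.sum_mul_le_sqrt_mul_sqrt _ _ _
    _ ≤ α * β := by
        simp only [sq_abs]
        exact mul_le_mul (Real.sqrt_le_iff.2 ⟨hα, ha⟩) (Real.sqrt_le_iff.2 ⟨hβ, hv⟩)
          (Real.sqrt_nonneg _) hα

/-- The Jacobian is Lipschitz around a parameter whose output columns are bounded. -/
theorem norm_netJac_sub_le {φ : ℝ → ℝ} (hφ : ContDiff ℝ 1 φ) {B : ℝ≥0}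
    (hB : ∀ x, |deriv φ x| ≤ B) (hlip : LipschitzWith B (deriv φ)) {u : Vec d} (hu : ‖u‖ = 1)
    {M : ℝ} (hM : 0 ≤ M) (θ θ' : Param k d n) (hθ' : ∀ j, ‖outCol j θ'‖ ≤ M) :
    ‖netJac φ u θ - netJac φ u θ'‖ ≤ B * (2 + M) / √(k : ℝ) * ‖θ - θ'‖ := by
  refine ContinuousLinearMap.opNorm_le_bound _ (by positivity) fun η => ?_
  have hφlip : ∀ x y, |φ x - φ y| ≤ B * |x - y| := fun x y => by
    have := Convex.norm_image_sub_le_of_norm_deriv_le (𝕜 := ℝ) (f := φ) (C := B) (s := univ)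
      (x := y) (y := x) (fun z _ => hφ.differentiable one_ne_zero z)
      (fun z _ => by simpa using hB z) convex_univ trivial trivial
    simpa using this
  have hdlip : ∀ x y, |deriv φ x - deriv φ y| ≤ B * |x - y| := fun x y => by
    simpa [Real.dist_eq] using hlip.dist_le_mul x y
  have hB0 : (0 : ℝ) ≤ B := B.2
  -- The splitting is arranged so that only the columns of `θ'` need the bound `M`; each of the
  -- three sums is estimated by Cauchy-Schwarz over the hidden units.
  have hdiff : (netJac φ u θ - netJac φ u θ') η = (1 / √(k : ℝ)) •
      (∑ j, (φ (preact u j θ) - φ (preact u j θ')) • outCol j η +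
        ∑ j, preact u j η • (deriv φ (preact u j θ) • outCol j (θ - θ')) +
        ∑ j, (deriv φ (preact u j θ) - deriv φ (preact u j θ')) •
          (preact u j η • outCol j θ')) := by
    rw [sub_apply, netJac_apply hφ, netJac_apply hφ, ← smul_sub,
      ← Finset.sum_sub_distrib, ← Finset.sum_add_distrib, ← Finset.sum_add_distrib]
    congr 1
    refine Finset.sum_congr rfl fun j _ => ?_
    rw [map_sub]
    module
  have hΔ : ∀ f : ℝ → ℝ, (∀ x y, |f x - f y| ≤ B * |x - y|) →
      ∑ j, (f (preact u j θ) - f (preact u j θ')) ^ 2 ≤ (B * ‖θ - θ'‖) ^ 2 := fun f hf => by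
    calc ∑ j, (f (preact u j θ) - f (preact u j θ')) ^ 2
        ≤ ∑ j, (B : ℝ) ^ 2 * preact u j (θ - θ') ^ 2 := by
          refine Finset.sum_le_sum fun j _ => ?_
          rw [← sq_abs, ← mul_pow, ← sq_abs (_ * _), abs_mul, abs_of_nonneg hB0, map_sub]
          gcongr
          exact hf _ _
      _ = (B : ℝ) ^ 2 * ∑ j, preact u j (θ - θ') ^ 2 := by rw [Finset.mul_sum]
      _ ≤ _ := by
          rw [mul_pow]
          gcongr
          exact sum_preact_sq_le hu _
  have h1 : ‖∑ j, (φ (preact u j θ) - φ (preact u j θ')) • outCol j η‖ ≤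
      B * ‖θ - θ'‖ * ‖η‖ :=
    norm_sum_smul_le _ _ _ (by positivity) (norm_nonneg _) (hΔ φ hφlip)
      (sum_norm_outCol_sq_le hu η)
  have h2 : ‖∑ j, preact u j η • (deriv φ (preact u j θ) • outCol j (θ - θ'))‖ ≤
      ‖η‖ * (B * ‖θ - θ'‖) := by
    refine norm_sum_smul_le _ _ _ (norm_nonneg _) (by positivity) (sum_preact_sq_le hu η) ?_
    rw [mul_pow]
    refine le_trans ?_ (mul_le_mul_of_nonneg_left (sum_norm_outCol_sq_le hu (θ - θ'))
      (sq_nonneg (B : ℝ)))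
    rw [Finset.mul_sum]
    refine Finset.sum_le_sum fun j _ => ?_
    rw [norm_smul, mul_pow]
    gcongr
    exact hB _
  have h3 : ‖∑ j, (deriv φ (preact u j θ) - deriv φ (preact u j θ')) •
      (preact u j η • outCol j θ')‖ ≤ B * ‖θ - θ'‖ * (M * ‖η‖) := by
    refine norm_sum_smul_le _ _ _ (by positivity) (by positivity) (hΔ _ hdlip) ?_
    rw [mul_pow]
    refine le_trans ?_ (mul_le_mul_of_nonneg_left (sum_preact_sq_le hu η) (sq_nonneg M))
    rw [Finset.mul_sum]
    refine Finset.sum_le_sum fun j _ => ?_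
    rw [norm_smul, mul_pow, mul_comm, Real.norm_eq_abs, sq_abs]
    gcongr
    exact hθ' j
  rw [hdiff, norm_smul, Real.norm_of_nonneg (by positivity)]
  calc 1 / √(k : ℝ) * _ ≤ 1 / √(k : ℝ) * (B * ‖θ - θ'‖ * ‖η‖ + ‖η‖ * (B * ‖θ - θ'‖) +
        B * ‖θ - θ'‖ * (M * ‖η‖)) := by
        gcongr
        exact (norm_add₃_le).trans (add_le_add (add_le_add h1 h2) h3)
    _ = _ := by ring

/-- The mean square activation of the hidden layer. -/
def meanSqAct (φ : ℝ → ℝ) (u : Vec d) (W : Fin k → Fin d → ℝ) : ℝ :=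
  (1 / (k : ℝ)) * ∑ j, φ (∑ l, W j l * u l) ^ 2

theorem preact_mkParam (u : Vec d) (W : Matrix (Fin k) (Fin d) ℝ) (V : Matrix (Fin n) (Fin k) ℝ)
    (j : Fin k) : preact u j (mkParam W V) = ∑ l, W j l * u l := by
  rw [preact_apply]
  rfl

/-- The smallest singular value of the Jacobian is controlled by the second layer alone. -/
theorem sqrt_meanSqAct_le_sigmaMinJac {φ : ℝ → ℝ} (hφ : ContDiff ℝ 1 φ) (hn : 0 < n) (u : Vec d)
    (W : Matrix (Fin k) (Fin d) ℝ) (V : Matrix (Fin n) (Fin k) ℝ) :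
    √(meanSqAct φ u W) ≤ sigmaMinJac φ u (mkParam W V) := by
  have : Nonempty (Fin n) := ⟨⟨0, hn⟩⟩
  have hsph : (Metric.sphere (0 : Vec n) 1).Nonempty :=
    NormedSpace.sphere_nonempty.2 zero_le_one
  refine le_csInf (hsph.image _) ?_
  rintro _ ⟨z, hz, rfl⟩
  have hz1 : ‖z‖ = 1 := by simpa using hz
  set a : Fin k → ℝ := fun j => (1 / √(k : ℝ)) * φ (∑ l, W j l * u l) with ha
  -- The test direction `z aᵀ` in the second layer, with `W`-part zero, satisfies `J η = ‖a‖² z` and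
  -- `‖η‖ = ‖a‖`. Pairing it with `Jᵀ z` gives `‖Jᵀ z‖ ≥ ‖a‖`.
  set η : Param k d n := mkParam 0 (Matrix.of fun i j => z i * a j) with hη
  have hΦ : ∑ j, a j ^ 2 = meanSqAct φ u W := by
    simp only [ha, mul_pow, meanSqAct, ← Finset.mul_sum, div_pow, one_pow,
      Real.sq_sqrt (Nat.cast_nonneg k)]
  have hzs : ∑ i, z i ^ 2 = 1 := by
    have := EuclideanSpace.norm_sq_eq z
    rw [hz1] at this
    simpa using this.symm
  have hηn : ‖η‖ ^ 2 = meanSqAct φ u W := by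
    rw [EuclideanSpace.norm_sq_eq, Fintype.sum_sum_type, Fintype.sum_prod_type,
      Fintype.sum_prod_type]
    simp [hη, mkParam, mul_pow, ← Finset.mul_sum, ← Finset.sum_mul, hΦ, hzs]
  have hJ : netJac φ u (mkParam W V) η = meanSqAct φ u W • z := by
    rw [netJac_apply hφ, Finset.smul_sum, ← hΦ, Finset.sum_smul]
    refine Finset.sum_congr rfl fun j _ => ?_
    have h1 : preact u j η = 0 := by simp [hη, preact_mkParam]
    have h2 : outCol j η = a j • z := by
      ext i
      simp [outCol_apply, hη, mkParam, mul_comm]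
    rw [h1, h2, preact_mkParam, mul_zero, zero_smul, add_zero, smul_smul, smul_smul]
    congr 1
    simp only [ha]
    ring
  have h0 : 0 ≤ meanSqAct φ u W := hΦ ▸ by positivity
  rcases h0.eq_or_lt with h0' | hpos
  · rw [← h0', Real.sqrt_zero]
    positivity
  have hηs : ‖η‖ = √(meanSqAct φ u W) := by
    rw [← hηn, Real.sqrt_sq (norm_nonneg _)]
  have h3 : inner ℝ ((netJac φ u (mkParam W V)).adjoint z) η = meanSqAct φ u W := by
    rw [ContinuousLinearMap.adjoint_inner_left, hJ, inner_smul_right, real_inner_self_eq_norm_sq,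
      hz1]
    ring
  have h4 := real_inner_le_norm ((netJac φ u (mkParam W V)).adjoint z) η
  rw [h3, hηs] at h4
  have h5 := Real.mul_self_sqrt h0
  have h6 := Real.sqrt_pos.2 hpos
  exact le_of_mul_le_mul_right (by rw [h5]; exact h4) h6

theorem norm_outCol_mkParam_le {D : ℝ} (W : Matrix (Fin k) (Fin d) ℝ)
    {V : Matrix (Fin n) (Fin k) ℝ} (hV : ∀ i j, |V i j| ≤ D) (hD : 0 ≤ D) (j : Fin k) :
    ‖outCol j (mkParam W V)‖ ≤ D * √(n : ℝ) := by
  rw [EuclideanSpace.norm_eq]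
  refine Real.sqrt_le_iff.2 ⟨by positivity, ?_⟩
  rw [mul_pow, Real.sq_sqrt (Nat.cast_nonneg n)]
  calc ∑ i, ‖outCol j (mkParam W V) i‖ ^ 2 ≤ ∑ _i : Fin n, D ^ 2 := by
        refine Finset.sum_le_sum fun i _ => ?_
        have : ‖outCol j (mkParam W V) i‖ ≤ D := hV i j
        gcongr
    _ = _ := by simp [mul_comm]

/-- A lower bound on the radius from the Lipschitz constant of the Jacobian. -/
theorem le_radiusR {φ : ℝ → ℝ} (hφ : ContDiff ℝ 1 φ) {B : ℝ≥0}
    (hB : ∀ x, |deriv φ x| ≤ B) (hlip : LipschitzWith B (deriv φ)) {u : Vec d} (hu : ‖u‖ = 1)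
    {θ₀ : Param k d n} {M : ℝ} (hM : 0 ≤ M) (hθ₀ : ∀ j, ‖outCol j θ₀‖ ≤ M) {ρ : ℝ≥0}
    (hρ : 2 * ρ * (B * (2 + (M + ρ)) / √(k : ℝ)) ≤ sigmaMinJac φ u θ₀) :
    (ρ : ℝ≥0∞) ≤ radiusR φ u θ₀ := by
  have hlipC : lipConst (netJac φ u) (Metric.closedBall θ₀ ρ) ≤
      ENNReal.ofReal (B * (2 + (M + ρ)) / √(k : ℝ)) := by
    refine iSup₂_le fun θ _ => iSup₂_le fun θ' hθ' => ?_
    refine ENNReal.div_le_of_le_mul ?_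
    rw [edist_dist, edist_dist, ← ENNReal.ofReal_mul (by positivity), dist_eq_norm, dist_eq_norm]
    refine ENNReal.ofReal_le_ofReal ?_
    -- Within distance `ρ` of `θ₀` each output column grows by at most `ρ`.
    refine norm_netJac_sub_le hφ hB hlip hu (by positivity) θ θ' fun j => ?_
    have h1 : ‖θ' - θ₀‖ ≤ ρ := by simpa [dist_eq_norm] using hθ'
    have h2 := norm_outCol_le hu j (θ' - θ₀)
    calc ‖outCol j θ'‖ = ‖outCol j θ₀ + outCol j (θ' - θ₀)‖ := by rw [map_sub]; congr 1; abel
      _ ≤ M + ρ := (norm_add_le _ _).trans (add_le_add (hθ₀ j) (h2.trans h1))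
  refine le_iSup₂_of_le (f := fun (ρ : ℝ≥0) (_ : 2 * (ρ : ℝ≥0∞) *
    lipConst (netJac φ u) (Metric.closedBall θ₀ ρ) ≤
    ENNReal.ofReal (sigmaMinJac φ u θ₀)) => (ρ : ℝ≥0∞)) ρ ?_ le_rfl
  refine (mul_le_mul_right hlipC _).trans ?_
  have h2 : (2 : ℝ≥0∞) * (ρ : ℝ≥0∞) = ENNReal.ofReal (2 * ρ) := by
    rw [ENNReal.ofReal_mul (by norm_num)]
    simp
  rw [h2, ← ENNReal.ofReal_mul (by positivity)]
  exact ENNReal.ofReal_le_ofReal hρ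

end Network

end

/-! ### Probability tools: conditioning and norms of sub-Gaussian vectors -/

/-- A probability bound that holds for every value of an independent variable holds jointly. -/
theorem ProbabilityTheory.IndepFun.measure_le_of_forall {Ω α β : Type*} [MeasurableSpace Ω]
    [MeasurableSpace α] [MeasurableSpace β] {μ : Measure Ω} [IsProbabilityMeasure μ] {X : Ω → α}
    {Y : Ω → β} (h : IndepFun X Y μ) (hX : AEMeasurable X μ) (hY : AEMeasurable Y μ)
    {S : Set (α × β)} (hS : MeasurableSet S) {δ : ℝ≥0∞}
    (hδ : ∀ᵐ ω' ∂μ, μ {ω | (X ω, Y ω') ∈ S} ≤ δ) : μ {ω | (X ω, Y ω) ∈ S} ≤ δ := by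
  have h1 : μ {ω | (X ω, Y ω) ∈ S} = (μ.map fun ω => (X ω, Y ω)) S :=
    (Measure.map_apply_of_aemeasurable (hX.prodMk hY) hS).symm
  have := Measure.isProbabilityMeasure_map hX
  have hms : Measurable fun y => (μ.map X) ((fun x => (x, y)) ⁻¹' S) :=
    measurable_measure_prodMk_right hS
  rw [h1, (indepFun_iff_map_prod_eq_prod_map_map hX hY).1 h, Measure.prod_apply_symm hS,
    lintegral_map' hms.aemeasurable hY]
  calc ∫⁻ ω', (μ.map X) ((fun x => (x, Y ω')) ⁻¹' S) ∂μ ≤ ∫⁻ _, δ ∂μ := by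
        refine lintegral_mono_ae ?_
        filter_upwards [hδ] with ω' hω'
        rw [Measure.map_apply_of_aemeasurable hX (measurable_prodMk_right hS)]
        exact hω'
    _ = δ := by simp

/-- Convexity of `x ↦ cosh (l √x)` on averages. -/
theorem cosh_sqrt_mean_le {ι : Type*} [Fintype ι] [Nonempty ι] (l : ℝ) (x : ι → ℝ) :
    Real.cosh (l * √((Fintype.card ι : ℝ)⁻¹ * ∑ i, x i ^ 2)) ≤
      (Fintype.card ι : ℝ)⁻¹ * ∑ i, Real.cosh (l * x i) := by
  have hcard : (0 : ℝ) < Fintype.card ι := by exact_mod_cast Fintype.card_pos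
  have h1 := Real.hasSum_cosh (l * √((Fintype.card ι : ℝ)⁻¹ * ∑ i, x i ^ 2))
  have h2 := (hasSum_sum fun i (_ : i ∈ Finset.univ) => Real.hasSum_cosh (l * x i)).mul_left
    ((Fintype.card ι : ℝ)⁻¹)
  -- Comparison of the power series of `cosh` term by term: only even powers occur, and each
  -- comparison is the power mean inequality for the squares.
  refine hasSum_le (fun j => ?_) h1 h2
  have hJ := Real.pow_arith_mean_le_arith_mean_pow Finset.univ (fun _ : ι => (Fintype.card ι : ℝ)⁻¹)
    (fun i => x i ^ 2) (fun _ _ => by positivity) (by simp [hcard.ne']) (fun _ _ => by positivity) j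
  rw [← Finset.mul_sum, ← Finset.mul_sum] at hJ
  rw [mul_pow, pow_mul (√_) 2 j, Real.sq_sqrt (by positivity), ← Finset.sum_div, ← mul_div_assoc]
  refine div_le_div_of_nonneg_right ?_ (by positivity)
  have hx : ∑ i, (l * x i) ^ (2 * j) = l ^ (2 * j) * ∑ i, (x i ^ 2) ^ j := by
    rw [Finset.mul_sum]
    exact Finset.sum_congr rfl fun i _ => by rw [mul_pow, pow_mul (x i)]
  rw [hx, mul_left_comm]
  exact mul_le_mul_of_nonneg_left hJ (by rw [pow_mul]; positivity)

theorem exp_le_two_mul_cosh (x : ℝ) : Real.exp x ≤ 2 * Real.cosh x := by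
  rw [Real.cosh_eq]
  linarith [Real.exp_pos (-x)]

/-- The Euclidean norm of a vector with sub-Gaussian entries, without any independence. -/
theorem measure_sqrt_mean_sq_ge_le {Ω ι : Type*} [MeasurableSpace Ω] {μ : Measure Ω}
    [IsProbabilityMeasure μ] [Fintype ι] [Nonempty ι] {X : ι → Ω → ℝ} {c : ℝ≥0} (hc : 0 < c)
    (hX : ∀ i, HasSubgaussianMGF (X i) c μ) {t : ℝ} (ht : 0 ≤ t) :
    μ {ω | t ≤ √((Fintype.card ι : ℝ)⁻¹ * ∑ i, X i ω ^ 2)} ≤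
      ENNReal.ofReal (2 * Real.exp (-t ^ 2 / (2 * c))) := by
  have hc' : (0 : ℝ) < c := hc
  -- This choice minimizes the Chernoff exponent `c l² / 2 - l t`.
  set l : ℝ := t / c with hl
  have hl0 : 0 ≤ l := by positivity
  have hcosh : ∀ i, Integrable (fun ω => Real.cosh (l * X i ω)) μ ∧
      ∫ ω, Real.cosh (l * X i ω) ∂μ ≤ Real.exp (c * l ^ 2 / 2) := fun i => by
    have h1 := (hX i).integrable_exp_mul l
    have h2 := (hX i).integrable_exp_mul (-l)
    have h3 := (hX i).mgf_le l
    have h4 := (hX i).mgf_le (-l)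
    simp only [mgf, neg_mul, neg_sq] at h2 h3 h4
    simp only [Real.cosh_eq]
    refine ⟨(h1.add h2).div_const 2, ?_⟩
    rw [integral_div, integral_add h1 h2]
    linarith
  have hcard : (0 : ℝ) < Fintype.card ι := by exact_mod_cast Fintype.card_pos
  set f : Ω → ℝ := fun ω => (Fintype.card ι : ℝ)⁻¹ * ∑ i, Real.cosh (l * X i ω) with hf
  have hfi : Integrable f μ := (integrable_finsetSum _ fun i _ => (hcosh i).1).const_mul _
  have hf0 : 0 ≤ᵐ[μ] f := Filter.Eventually.of_forall fun ω =>
    mul_nonneg (by positivity) (Finset.sum_nonneg fun i _ => (Real.cosh_pos _).le)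
  have hfint : ∫ ω, f ω ∂μ ≤ Real.exp (c * l ^ 2 / 2) := by
    rw [integral_const_mul, integral_finsetSum _ fun i _ => (hcosh i).1, inv_mul_le_iff₀ hcard]
    calc ∑ i, ∫ ω, Real.cosh (l * X i ω) ∂μ ≤ ∑ _i : ι, Real.exp (c * l ^ 2 / 2) :=
          Finset.sum_le_sum fun i _ => (hcosh i).2
      _ = _ := by simp
  have hmarkov := mul_meas_ge_le_integral_of_nonneg hf0 hfi (Real.exp (l * t) / 2)
  have hsub : {ω | t ≤ √((Fintype.card ι : ℝ)⁻¹ * ∑ i, X i ω ^ 2)} ⊆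
      {ω | Real.exp (l * t) / 2 ≤ f ω} := fun ω hω => by
    have h1 := cosh_sqrt_mean_le l fun i => X i ω
    have h2 : Real.exp (l * t) ≤
        Real.exp (l * √((Fintype.card ι : ℝ)⁻¹ * ∑ i, X i ω ^ 2)) :=
      Real.exp_le_exp.2 (mul_le_mul_of_nonneg_left hω hl0)
    have h3 := exp_le_two_mul_cosh (l * √((Fintype.card ι : ℝ)⁻¹ * ∑ i, X i ω ^ 2))
    rw [mem_ofPred_eq]
    linarith
  refine (measure_mono hsub).trans ?_
  rw [← ofReal_measureReal]
  refine ENNReal.ofReal_le_ofReal ?_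
  have h5 : μ.real {ω | Real.exp (l * t) / 2 ≤ f ω} ≤
      2 * (Real.exp (c * l ^ 2 / 2) * Real.exp (-(l * t))) := by
    have h6 := hmarkov.trans hfint
    have h7 : Real.exp (-(l * t)) * Real.exp (l * t) = 1 := by rw [← Real.exp_add]; simp
    have h8 := mul_le_mul_of_nonneg_left h6 (Real.exp_pos (-(l * t))).le
    have h9 : Real.exp (-(l * t)) * (Real.exp (l * t) / 2 *
        μ.real {ω | Real.exp (l * t) / 2 ≤ f ω}) =
        μ.real {ω | Real.exp (l * t) / 2 ≤ f ω} / 2 := by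
      linear_combination (μ.real {ω | Real.exp (l * t) / 2 ≤ f ω} / 2) * h7
    linarith
  refine h5.trans_eq ?_
  rw [← Real.exp_add]
  congr 2
  rw [hl]
  field_simp
  ring

/-! ### Concentration of the mean square activation -/

section Gaussian

variable {Ω : Type*} [MeasurableSpace Ω] {μ : Measure Ω} {k d : ℕ}
  {W : Ω → Fin k → Fin d → ℝ}

/-- A row of independent standard Gaussians in a unit direction is standard Gaussian. -/
theorem map_preact_eq_gaussianReal (hlaw : ∀ j l, HasLaw (fun ω => W ω j l) (gaussianReal 0 1) μ)
    (hind : iIndepFun (fun (p : Fin k × Fin d) ω => W ω p.1 p.2) μ) {u : Vec d} (hu : ‖u‖ = 1)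
    (j : Fin k) : HasLaw (fun ω => ∑ l, W ω j l * u l) (gaussianReal 0 1) μ := by
  have hrow : iIndepFun (fun l ω => W ω j l) μ :=
    hind.precomp (g := fun l : Fin d => (j, l)) fun a b h => (Prod.ext_iff.1 h).2
  have hind' : iIndepFun (fun l ω => W ω j l * u l) μ :=
    hrow.comp (fun l x => x * u l) fun l => by fun_prop
  have hG : ∀ l, HasGaussianLaw (fun ω => W ω j l * u l) μ := fun l =>
    (gaussianReal_mul_const (hlaw j l) (u l)).hasGaussianLaw
  have hint : ∀ l, ∫ ω, W ω j l ∂μ = 0 := fun l => by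
    rw [(hlaw j l).integral_eq]; simp
  have hS : HasGaussianLaw (fun ω => ∑ l, W ω j l * u l) μ := hind'.hasGaussianLaw_fun_sum hG
  refine ⟨hS.aemeasurable, ?_⟩
  rw [hS.map_eq_gaussianReal]
  have hmean : ∫ ω, ∑ l, W ω j l * u l ∂μ = 0 := by
    rw [integral_finsetSum _ fun l _ => (hG l).integrable]
    simp [integral_mul_const, hint]
  have hvar : Var[fun ω => ∑ l, W ω j l * u l; μ] = 1 := by
    have h1 := IndepFun.variance_sum (s := Finset.univ) (fun l _ => (hG l).memLp_two)
      (fun a _ b _ hab => hind'.indepFun hab)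
    have h2 : (∑ l, fun ω => W ω j l * u l) = fun ω => ∑ l, W ω j l * u l := by
      ext ω; simp
    rw [h2] at h1
    rw [h1]
    have h3 : ∀ l, Var[fun ω => W ω j l * u l; μ] = u l ^ 2 := fun l => by
      have h4 : Var[fun ω => W ω j l; μ] = 1 := by
        rw [(hlaw j l).variance_eq]; simp
      simp only [mul_comm (W _ j l)]
      rw [variance_const_mul, h4, mul_one]
    simp only [h3]
    have := EuclideanSpace.norm_sq_eq u
    rw [hu] at this
    simpa using this.symm
  rw [hmean, hvar]
  simp

/-- Different hidden units use disjoint blocks of Gaussian entries. Pairwise independence is enough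
for the variance of the sum. -/
theorem indepFun_preact (hlaw : ∀ j l, HasLaw (fun ω => W ω j l) (gaussianReal 0 1) μ)
    (hind : iIndepFun (fun (p : Fin k × Fin d) ω => W ω p.1 p.2) μ) (u : Vec d)
    {j j' : Fin k} (hj : j ≠ j') :
    IndepFun (fun ω => ∑ l, W ω j l * u l) (fun ω => ∑ l, W ω j' l * u l) μ := by
  classical
  set S : Fin k → Finset (Fin k × Fin d) := fun j => Finset.univ.image fun l => (j, l) with hS
  have hmem : ∀ j l, (j, l) ∈ S j := fun j l => by simp [hS]
  have hdisj : Disjoint (S j) (S j') := by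
    rw [Finset.disjoint_left]
    rintro ⟨a, b⟩ h1 h2
    simp only [hS, Finset.mem_image, Finset.mem_univ, true_and, Prod.mk.injEq] at h1 h2
    obtain ⟨_, h1, _⟩ := h1
    obtain ⟨_, h2, _⟩ := h2
    exact hj (h1.trans h2.symm)
  have h := hind.indepFun_finset₀ (S j) (S j') hdisj fun p => (hlaw p.1 p.2).aemeasurable
  exact h.comp (φ := fun x => ∑ l, x ⟨(j, l), hmem j l⟩ * u l)
    (ψ := fun x => ∑ l, x ⟨(j', l), hmem j' l⟩ * u l) (by fun_prop) (by fun_prop)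

/-- The second moment of the activation at a standard Gaussian. -/
noncomputable def actMoment (φ : ℝ → ℝ) : ℝ := ∫ x, φ x ^ 2 ∂gaussianReal 0 1

/-- The variance of the squared activation at a standard Gaussian. -/
noncomputable def actVar (φ : ℝ → ℝ) : ℝ := Var[fun x => φ x ^ 2; gaussianReal 0 1]

/-- A bounded derivative makes `φ` grow at most linearly, so it has a fourth Gaussian moment; Hölder
with exponents `4, 4, 2` passes to the square. -/
theorem SmoothActivation.memLp_sq {φ : ℝ → ℝ} (hφ : SmoothActivation φ) :
    MemLp (fun x => φ x ^ 2) 2 (gaussianReal 0 1) := by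
  obtain ⟨hφ1, B, -, hB, -⟩ := hφ
  have hcont : Continuous φ := hφ1.continuous
  have hbound : ∀ x, |φ x| ≤ |φ 0| + B * |x| := fun x => by
    have := Convex.norm_image_sub_le_of_norm_deriv_le (𝕜 := ℝ) (f := φ) (C := B) (s := univ)
      (x := 0) (y := x) (fun z _ => hφ1.differentiable one_ne_zero z)
      (fun z _ => by simpa using hB z) convex_univ trivial trivial
    simp only [Real.norm_eq_abs, sub_zero] at this
    have h2 := abs_sub_abs_le_abs_sub (φ x) (φ 0)
    linarith
  have h4 : MemLp φ 4 (gaussianReal 0 1) := by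
    have hx : MemLp (fun x : ℝ => |x|) 4 (gaussianReal 0 1) :=
      (memLp_id_gaussianReal' 4 (by norm_num)).abs
    have hid : MemLp (fun x : ℝ => |φ 0| + B * |x|) 4 (gaussianReal 0 1) :=
      (memLp_const |φ 0|).add (hx.const_mul (B : ℝ))
    refine hid.mono hcont.aestronglyMeasurable (Filter.Eventually.of_forall fun x => ?_)
    rw [Real.norm_eq_abs, Real.norm_eq_abs]
    exact (hbound x).trans (le_abs_self _)
  have : ENNReal.HolderTriple 4 4 2 := ⟨by
    have h : (4 : ℝ≥0∞)⁻¹ = 2⁻¹ * 2⁻¹ := by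
      rw [← ENNReal.mul_inv (by simp) (by simp)]; norm_num
    rw [h, ← mul_add, ENNReal.inv_two_add_inv_two, mul_one]⟩
  have h := h4.mul (r := 2) h4
  simp only [sq]
  exact h

/-- The set where `φ ≠ 0` is open and nonempty, and Gaussian measure charges such sets. -/
theorem actMoment_pos {φ : ℝ → ℝ} (hφ : SmoothActivation φ) (hφ0 : φ ≠ 0) : 0 < actMoment φ := by
  have hi : Integrable (fun x => φ x ^ 2) (gaussianReal 0 1) :=
    hφ.memLp_sq.integrable (by norm_num)
  have hcont : Continuous φ := hφ.1.continuous
  unfold actMoment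
  rw [integral_pos_iff_support_of_nonneg (fun x => sq_nonneg _) hi]
  have hopen : IsOpen (Function.support fun x => φ x ^ 2) := (hcont.pow 2).isOpen_support
  obtain ⟨x, hx⟩ := Function.ne_iff.1 hφ0
  have hvol : volume (Function.support fun x => φ x ^ 2) ≠ 0 :=
    hopen.measure_ne_zero _ ⟨x, by simpa using hx⟩
  exact pos_iff_ne_zero.2 fun h0 =>
    hvol ((gaussianReal_absolutelyContinuous' 0 one_ne_zero) h0)

theorem measurable_meanSqAct {φ : ℝ → ℝ} (hφ : Continuous φ) :
    Measurable fun z : (Fin k → Fin d → ℝ) × Vec d => meanSqAct φ z.2 z.1 := by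
  unfold meanSqAct
  fun_prop

theorem hasLaw_memLp_sq {φ : ℝ → ℝ} (hφ : SmoothActivation φ) {Y : Ω → ℝ}
    (hY : HasLaw Y (gaussianReal 0 1) μ) : MemLp (fun ω => φ (Y ω) ^ 2) 2 μ ∧
      ∫ ω, φ (Y ω) ^ 2 ∂μ = actMoment φ ∧ Var[fun ω => φ (Y ω) ^ 2; μ] = actVar φ := by
  have hm : Continuous fun x => φ x ^ 2 := hφ.1.continuous.pow 2
  have hM := hφ.memLp_sq
  rw [← hY.map_eq] at hM
  refine ⟨hM.comp_of_map hY.aemeasurable, ?_, ?_⟩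
  · rw [actMoment, ← hY.map_eq, integral_map hY.aemeasurable hm.aestronglyMeasurable]
  · rw [actVar, ← hY.map_eq, variance_map hm.aemeasurable hY.aemeasurable]
    rfl

/-- Mean and variance of the mean square activation at a fixed unit input. -/
theorem meanSqAct_moments [IsProbabilityMeasure μ] {φ : ℝ → ℝ} (hφ : SmoothActivation φ)
    (hk : 0 < k)
    (hlaw : ∀ j l, HasLaw (fun ω => W ω j l) (gaussianReal 0 1) μ)
    (hind : iIndepFun (fun (p : Fin k × Fin d) ω => W ω p.1 p.2) μ) {u : Vec d} (hu : ‖u‖ = 1) :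
    MemLp (fun ω => meanSqAct φ u (W ω)) 2 μ ∧ ∫ ω, meanSqAct φ u (W ω) ∂μ = actMoment φ ∧
      Var[fun ω => meanSqAct φ u (W ω); μ] = actVar φ / k := by
  have hk' : (k : ℝ) ≠ 0 := by exact_mod_cast hk.ne'
  have hY := fun j => hasLaw_memLp_sq hφ (map_preact_eq_gaussianReal hlaw hind hu j)
  have hsum : MemLp (fun ω => ∑ j, φ (∑ l, W ω j l * u l) ^ 2) 2 μ :=
    memLp_finsetSum _ fun j _ => (hY j).1
  unfold meanSqAct
  refine ⟨hsum.const_mul _, ?_, ?_⟩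
  · rw [integral_const_mul, integral_finsetSum _ fun j _ => (hY j).1.integrable (by norm_num)]
    simp only [(hY _).2.1]
    simp
    field_simp
  · have hm : Measurable fun x => φ x ^ 2 := (hφ.1.continuous.pow 2).measurable
    have h1 := IndepFun.variance_sum (s := Finset.univ) (fun j _ => (hY j).1)
      (fun a _ b _ hab => (indepFun_preact hlaw hind u hab).comp hm hm)
    have h2 : (∑ j, fun ω => φ (∑ l, W ω j l * u l) ^ 2) =
        fun ω => ∑ j, φ (∑ l, W ω j l * u l) ^ 2 := by
      ext ω; simp
    rw [h2] at h1
    rw [variance_const_mul, h1]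
    simp only [(hY _).2.2]
    simp
    field_simp

theorem measure_meanSqAct_far_le [IsProbabilityMeasure μ] {φ : ℝ → ℝ} (hφ : SmoothActivation φ)
    (hφ0 : φ ≠ 0) (hk : 0 < k)
    (hlaw : ∀ j l, HasLaw (fun ω => W ω j l) (gaussianReal 0 1) μ)
    (hind : iIndepFun (fun (p : Fin k × Fin d) ω => W ω p.1 p.2) μ) {u : Vec d} (hu : ‖u‖ = 1) :
    μ {ω | actMoment φ / 2 ≤ |meanSqAct φ u (W ω) - actMoment φ|} ≤
      ENNReal.ofReal (4 * actVar φ / (k * actMoment φ ^ 2)) := by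
  obtain ⟨h1, h2, h3⟩ := meanSqAct_moments hφ hk hlaw hind hu
  have hp := actMoment_pos hφ hφ0
  have h := meas_ge_le_variance_div_sq h1 (half_pos hp)
  rw [h2, h3] at h
  refine h.trans_eq ?_
  congr 1
  field_simp
  norm_num

theorem meanSqAct_nonneg (φ : ℝ → ℝ) (u : Vec d) (w : Fin k → Fin d → ℝ) :
    0 ≤ meanSqAct φ u w := by
  unfold meanSqAct
  positivity

/-- Markov's inequality gives a bound free of `k`, usable before the width is known to exceed a
multiple of `n`. -/
theorem measure_meanSqAct_large_le [IsProbabilityMeasure μ] {φ : ℝ → ℝ}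
    (hφ : SmoothActivation φ) (hφ0 : φ ≠ 0)
    (hk : 0 < k) (hlaw : ∀ j l, HasLaw (fun ω => W ω j l) (gaussianReal 0 1) μ)
    (hind : iIndepFun (fun (p : Fin k × Fin d) ω => W ω p.1 p.2) μ) {u : Vec d} (hu : ‖u‖ = 1) :
    μ {ω | 4 * actMoment φ ≤ meanSqAct φ u (W ω)} ≤ ENNReal.ofReal (1 / 4) := by
  obtain ⟨h1, h2, -⟩ := meanSqAct_moments hφ hk hlaw hind hu
  have hp := actMoment_pos hφ hφ0
  have h := mul_meas_ge_le_integral_of_nonneg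
    (Filter.Eventually.of_forall fun ω => meanSqAct_nonneg φ u (W ω))
    (h1.integrable (by norm_num)) (4 * actMoment φ)
  rw [h2] at h
  rw [← ofReal_measureReal]
  refine ENNReal.ofReal_le_ofReal ?_
  nlinarith

end Gaussian

/-! ### Size of the network output at random initialization -/

/-- The norm of the network output in terms of the entries of the layers. -/
noncomputable def outNorm (φ : ℝ → ℝ) {k d n : ℕ} (u : Vec d) (w : Fin k → Fin d → ℝ)
    (v : Fin n → Fin k → ℝ) : ℝ :=
  √(∑ i, (∑ j, (1 / √(k : ℝ) * φ (∑ l, w j l * u l)) * v i j) ^ 2)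

theorem norm_net_mkParam {k d n : ℕ} (φ : ℝ → ℝ) (u : Vec d) (W : Matrix (Fin k) (Fin d) ℝ)
    (V : Matrix (Fin n) (Fin k) ℝ) : ‖net φ u (mkParam W V)‖ = outNorm φ u W V := by
  unfold outNorm
  rw [EuclideanSpace.norm_eq]
  congr 1
  refine Finset.sum_congr rfl fun i _ => ?_
  rw [Real.norm_eq_abs, sq_abs, net_eq_sum]
  congr 1
  simp only [PiLp.smul_apply, WithLp.ofLp_sum, Finset.sum_apply, smul_eq_mul, Finset.mul_sum]
  refine Finset.sum_congr rfl fun j _ => ?_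
  rw [preact_mkParam, outCol_apply, ← mul_assoc]
  rfl

theorem measurable_outNorm {k d n : ℕ} {φ : ℝ → ℝ} (hφ : Continuous φ) :
    Measurable fun z : (Fin n → Fin k → ℝ) × Vec d × (Fin k → Fin d → ℝ) =>
      outNorm φ z.2.1 z.2.2 z.1 := by
  unfold outNorm
  fun_prop

theorem ae_norm_eq_one_uniformSphere (d : ℕ) : ∀ᵐ v ∂uniformSphere d, ‖v‖ = 1 := by
  refine Measure.ae_smul_measure ?_ _
  rw [ae_map_iff measurable_subtype_coe.aemeasurable
    (measurableSet_eq_fun measurable_norm measurable_const)]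
  exact Filter.Eventually.of_forall fun x => by simp

theorem ProbabilityTheory.HasSubgaussianMGF.weaken {Ω : Type*} [MeasurableSpace Ω] {μ : Measure Ω}
    {X : Ω → ℝ} {c c' : ℝ≥0} (h : HasSubgaussianMGF X c μ) (hc : c ≤ c') :
    HasSubgaussianMGF X c' μ :=
  ⟨h.integrable_exp_mul, fun t => (h.mgf_le t).trans (Real.exp_le_exp.2 (by gcongr))⟩

namespace RandomInit

variable {Ω : Type*} [MeasurableSpace Ω] {μ : Measure Ω} {D : ℝ}
  {k d n : ℕ} {u : Ω → Vec d} {W : Ω → Matrix (Fin k) (Fin d) ℝ}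
  {V : Ω → Matrix (Fin n) (Fin k) ℝ}

theorem norm_u (h : RandomInit μ D u W V) : ∀ᵐ ω ∂μ, ‖u ω‖ = 1 := by
  have := ae_norm_eq_one_uniformSphere d
  rw [← h.u_law.map_eq] at this
  exact ae_of_ae_map h.u_law.aemeasurable this

theorem aemeasurable_W (h : RandomInit μ D u W V) :
    AEMeasurable (fun ω (j : Fin k) (l : Fin d) => W ω j l) μ :=
  aemeasurable_pi_lambda _ fun j => aemeasurable_pi_lambda _ fun l => (h.W_law j l).aemeasurable

theorem aemeasurable_V_apply (h : RandomInit μ D u W V) (i : Fin n) (j : Fin k) :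
    AEMeasurable (fun ω => V ω i j) μ :=
  (measurable_pi_apply i).comp_aemeasurable (h.V_col_ident j j).aemeasurable_fst

theorem aemeasurable_V (h : RandomInit μ D u W V) :
    AEMeasurable (fun ω (i : Fin n) (j : Fin k) => V ω i j) μ :=
  aemeasurable_pi_lambda _ fun i => aemeasurable_pi_lambda _ fun j => h.aemeasurable_V_apply i j

theorem measure_meanSqAct_far_le [IsProbabilityMeasure μ] (h : RandomInit μ D u W V) {φ : ℝ → ℝ}
    (hφ : SmoothActivation φ) (hφ0 : φ ≠ 0) (hk : 0 < k) :
    μ {ω | actMoment φ / 2 ≤ |meanSqAct φ (u ω) (W ω) - actMoment φ|} ≤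
      ENNReal.ofReal (4 * actVar φ / (k * actMoment φ ^ 2)) := by
  have hm := measurable_meanSqAct (k := k) (d := d) hφ.1.continuous
  refine h.W_indep_u.measure_le_of_forall h.aemeasurable_W h.u_law.aemeasurable
    (S := {z | actMoment φ / 2 ≤ |meanSqAct φ z.2 z.1 - actMoment φ|})
    (measurableSet_le measurable_const (hm.sub_const _).abs) ?_
  filter_upwards [h.norm_u] with ω hω
  exact _root_.measure_meanSqAct_far_le hφ hφ0 hk h.W_law h.W_indep hω

theorem measure_meanSqAct_large_le [IsProbabilityMeasure μ] (h : RandomInit μ D u W V) {φ : ℝ → ℝ}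
    (hφ : SmoothActivation φ) (hφ0 : φ ≠ 0) (hk : 0 < k) :
    μ {ω | 4 * actMoment φ ≤ meanSqAct φ (u ω) (W ω)} ≤ ENNReal.ofReal (1 / 4) := by
  have hm := measurable_meanSqAct (k := k) (d := d) hφ.1.continuous
  refine h.W_indep_u.measure_le_of_forall h.aemeasurable_W h.u_law.aemeasurable
    (S := {z | 4 * actMoment φ ≤ meanSqAct φ z.2 z.1}) (measurableSet_le measurable_const hm) ?_
  filter_upwards [h.norm_u] with ω hω
  exact _root_.measure_meanSqAct_large_le hφ hφ0 hk h.W_law h.W_indep hω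

/-- Tail of the network output for a fixed input and first layer. -/
theorem measure_outNorm_fixed_le [IsProbabilityMeasure μ] (h : RandomInit μ D u W V) (φ : ℝ → ℝ)
    (hn : 0 < n)
    {D' : ℝ} (hD' : 0 < D') (hD : D ≤ D') {v : Vec d} {w : Fin k → Fin d → ℝ} {P : ℝ} (hP : 0 < P)
    (hw : meanSqAct φ v w ≤ P) {t : ℝ} (ht : 0 ≤ t) :
    μ {ω | √(n : ℝ) * t ≤ outNorm φ v w (V ω)} ≤
      ENNReal.ofReal (2 * Real.exp (-t ^ 2 / (2 * (P * D' ^ 2)))) := by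
  have : Nonempty (Fin n) := ⟨⟨0, hn⟩⟩
  have hn' : (0 : ℝ) < n := by exact_mod_cast hn
  set a : Fin k → ℝ := fun j => 1 / √(k : ℝ) * φ (∑ l, w j l * v l) with ha
  have ha2 : ∑ j, a j ^ 2 ≤ P := by
    refine le_trans (le_of_eq ?_) hw
    simp only [ha, mul_pow, meanSqAct, ← Finset.mul_sum, div_pow, one_pow,
      Real.sq_sqrt (Nat.cast_nonneg k)]
  set c : ℝ≥0 := ⟨P * D' ^ 2, by positivity⟩ with hc
  have hc0 : 0 < c := by
    rw [← NNReal.coe_pos]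
    exact mul_pos hP (pow_pos hD' 2)
  -- Hoeffding's lemma on `[-D', D']` has variance proxy `((D' - (-D')) / 2)² = D'²`.
  set c₀ : ℝ≥0 := (‖D' - -D'‖₊ / 2) ^ 2 with hc₀_def
  have hc₀ : (c₀ : ℝ) = D' ^ 2 := by
    rw [hc₀_def]
    push_cast
    rw [Real.norm_eq_abs, div_pow, sq_abs]
    ring
  have hsub : ∀ i, HasSubgaussianMGF (fun ω => ∑ j, a j * V ω i j) c μ := fun i => by
    have hind : iIndepFun (fun j ω => a j * V ω i j) μ :=
      h.V_col_indep.comp (fun j x => a j * x i) fun j => by fun_prop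
    have h1 : ∀ j, HasSubgaussianMGF (fun ω => V ω i j) c₀ μ := fun j => by
      refine hasSubgaussianMGF_of_mem_Icc_of_integral_eq_zero (h.aemeasurable_V_apply i j) ?_
        (h.V_centered i j)
      filter_upwards [h.V_bound] with ω hω
      exact abs_le.1 ((hω i j).trans hD)
    have h2 : ∀ j, HasSubgaussianMGF (fun ω => a j * V ω i j) (‖a j‖₊ ^ 2 * c₀) μ := fun j =>
      ((h1 j).const_mul (a j)).weaken (mul_le_mul_left (NNReal.coe_le_coe.1 (by
        rw [NNReal.coe_pow, coe_nnnorm, Real.norm_eq_abs, sq_abs]; rfl)) _)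
    refine (HasSubgaussianMGF.sum_of_iIndepFun hind (s := Finset.univ) fun j _ => h2 j).weaken ?_
    rw [← NNReal.coe_le_coe, ← Finset.sum_mul, NNReal.coe_mul, NNReal.coe_sum, hc₀]
    simp only [NNReal.coe_pow, coe_nnnorm, Real.norm_eq_abs, sq_abs]
    exact mul_le_mul_of_nonneg_right ha2 (sq_nonneg D')
  have key := measure_sqrt_mean_sq_ge_le hc0 hsub ht
  refine (measure_mono fun ω hω => ?_).trans key
  replace hω : √(n : ℝ) * t ≤ outNorm φ v w (V ω) := hω
  unfold outNorm at hω
  rw [mem_ofPred_eq, Fintype.card_fin, Real.sqrt_mul (by positivity), Real.sqrt_inv,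
    ← div_eq_inv_mul, le_div_iff₀' (Real.sqrt_pos.2 hn')]
  exact hω

/-- Conditioning on `(u, W)` leaves only the randomness of `V`. The bound on the activations is part
of the event because the tail at fixed `(u, W)` depends on it. -/
theorem measure_outNorm_le [IsProbabilityMeasure μ] (h : RandomInit μ D u W V) {φ : ℝ → ℝ}
    (hφ : Continuous φ) (hn : 0 < n) {D' : ℝ} (hD' : 0 < D') (hD : D ≤ D') {P : ℝ} (hP : 0 < P)
    {t : ℝ} (ht : 0 ≤ t) :
    μ {ω | meanSqAct φ (u ω) (W ω) ≤ P ∧ √(n : ℝ) * t ≤ outNorm φ (u ω) (W ω) (V ω)} ≤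
      ENNReal.ofReal (2 * Real.exp (-t ^ 2 / (2 * (P * D' ^ 2)))) := by
  have hm : Measurable fun z : (Fin n → Fin k → ℝ) × Vec d × (Fin k → Fin d → ℝ) =>
      meanSqAct φ z.2.1 z.2.2 := by
    unfold meanSqAct
    fun_prop
  have hS : MeasurableSet {z : (Fin n → Fin k → ℝ) × Vec d × (Fin k → Fin d → ℝ) |
      meanSqAct φ z.2.1 z.2.2 ≤ P ∧ √(n : ℝ) * t ≤ outNorm φ z.2.1 z.2.2 z.1} :=
    (measurableSet_le hm measurable_const).inter
      (measurableSet_le measurable_const (measurable_outNorm hφ))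
  have hall : ∀ v w, μ {ω | meanSqAct φ v w ≤ P ∧ √(n : ℝ) * t ≤ outNorm φ v w (V ω)} ≤
      ENNReal.ofReal (2 * Real.exp (-t ^ 2 / (2 * (P * D' ^ 2)))) := fun v w => by
    by_cases hw : meanSqAct φ v w ≤ P
    · exact (measure_mono fun ω hω => hω.2).trans
        (h.measure_outNorm_fixed_le φ hn hD' hD hP hw ht)
    · simp [hw]
  exact h.V_indep.measure_le_of_forall h.aemeasurable_V
    (h.u_law.aemeasurable.prodMk h.aemeasurable_W) hS
    (Filter.Eventually.of_forall fun ω' => hall (u ω') (W ω'))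

end RandomInit

/-! ### From the width to the initialization condition -/

/-- Since `c n ≤ q²` and `n ≥ 1`, both `2` and `D √n` are `O(q)`. The left side is then `O(q² /
√k)`, and `K` is the constant for which `√k ≥ K q²` brings it below `s`. -/
theorem width_suffices {s B D c q n k K : ℝ} (hs : 0 < s) (hB : 0 ≤ B) (hD : 0 ≤ D) (hc : 0 < c)
    (hq : 0 < q) (hn : 1 ≤ n) (hnq : c * n ≤ q ^ 2)
    (hK : K = 8 * B / s ^ 2 * ((2 + D) / √c + 4 / s)) (hk0 : 0 < k) (hk : K ^ 2 * n * q ^ 4 ≤ k) :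
    2 * (4 * q / s) * (B * (2 + (D * √n + 4 * q / s)) / √k) ≤ s := by
  have hK0 : 0 ≤ K := by rw [hK]; positivity
  have hsc : 0 < √c := Real.sqrt_pos.2 hc
  have h1 : K * q ^ 2 ≤ √k := by
    refine Real.le_sqrt_of_sq_le ?_
    calc (K * q ^ 2) ^ 2 = K ^ 2 * 1 * q ^ 4 := by ring
      _ ≤ K ^ 2 * n * q ^ 4 := by gcongr
      _ ≤ k := hk
  have h2 : √n ≤ q / √c := by
    rw [le_div_iff₀ hsc, ← Real.sqrt_mul (by linarith), mul_comm]
    exact Real.sqrt_le_iff.2 ⟨hq.le, hnq⟩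
  have h3 : 1 ≤ √n := Real.one_le_sqrt.2 hn
  have h4 : 2 + (D * √n + 4 * q / s) ≤ q * ((2 + D) / √c + 4 / s) := by
    calc 2 + (D * √n + 4 * q / s) ≤ 2 * (q / √c) + (D * (q / √c) + 4 * q / s) := by
          gcongr
          linarith
      _ = _ := by ring
  have hk' : 0 < √k := Real.sqrt_pos.2 hk0
  rw [← mul_div_assoc, div_le_iff₀ hk']
  calc 2 * (4 * q / s) * (B * (2 + (D * √n + 4 * q / s)))
      ≤ 2 * (4 * q / s) * (B * (q * ((2 + D) / √c + 4 / s))) := by gcongr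
    _ = s * (K * q ^ 2) := by rw [hK]; field_simp; ring
    _ ≤ s * √k := by gcongr

section Deterministic

variable {k d n m : ℕ} {C : ℝ} {F : Vec n → Vec m} {xbar : Vec n} {ε : Vec m} {L : Vec m → ℝ}
  {ψ : ℝ → ℝ} {r₀ : ℝ} {φ : ℝ → ℝ} {u : Vec d} {Θ : Set (Param k d n)} {θ₀ : Param k d n}

/-- The desingularized loss level dominates `σ_F` times the radius of the initial output. -/
theorem sigmaF_mul_le_two_mul (hC : 0 ≤ C) (hF : ContDiff ℝ 1 F)
    (hL : ContDiff ℝ 1 L) (hL' : LipschitzOnBounded (gradient L)) (hmin : IsLeast (range L) 0)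
    (hzero : ∀ v, L v = 0 ↔ v = F xbar + ε) (hKL : KLInequality L ψ r₀)
    (hr : lossLevel C d F xbar ε L < r₀) (hθ₀ : θ₀ ∈ Θ) (hJ : fderiv ℝ F (net φ u θ₀) ≠ 0)
    (hx : ‖net φ u θ₀‖ ≤ C * √(n * Real.log d)) :
    C * √(n * Real.log d) * sigmaF φ F u Θ ≤ 2 * ψ (lossLevel C d F xbar ε L) := by
  have hm : 0 < m := by
    rcases Nat.eq_zero_or_pos m with rfl | hm
    · exact absurd (ContinuousLinearMap.ext fun z => Subsingleton.elim _ _) hJ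
    · exact hm
  have h1 := misfitRadius_le_two_mul hm hC hL hL' hmin hzero hKL hr
  have h2 : sigmaF φ F u Θ ≤ LF0 C d F :=
    (sigmaF_le_norm_fderiv hθ₀ hJ).trans (norm_fderiv_le_LF0 hF hx)
  have h3 : C * √(n * Real.log d) * sigmaF φ F u Θ ≤ C * √(n * Real.log d) * LF0 C d F := by
    gcongr
  have h4 : (0 : ℝ) ≤ √(m : ℝ) * (supNorm (F xbar) + supNorm ε) :=
    mul_nonneg (Real.sqrt_nonneg _) (add_nonneg (norm_nonneg _) (norm_nonneg _))
  unfold misfitRadius at h1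
  linarith

/-- The ratio of the desingularized loss level and `σ_F` is at least of order `√n`, and the width
is large compared to it. -/
theorem exists_ratio_bounds (hC : 0 < C) (hn : 0 < n) (hd : 1 / 2 ≤ Real.log d)
    (hF : ContDiff ℝ 1 F) (hL : ContDiff ℝ 1 L) (hL' : LipschitzOnBounded (gradient L))
    (hmin : IsLeast (range L) 0) (hzero : ∀ v, L v = 0 ↔ v = F xbar + ε)
    (hKL : KLInequality L ψ r₀) (hr : lossLevel C d F xbar ε L < r₀) (hθ₀ : θ₀ ∈ Θ)
    (hJ : fderiv ℝ F (net φ u θ₀) ≠ 0) (hσ : 0 < sigmaF φ F u Θ) {C' : ℝ}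
    (hk : C' * (sigmaF φ F u Θ ^ 4)⁻¹ * n * ψ (lossLevel C d F xbar ε L) ^ 4 ≤ k)
    (hx : ‖net φ u θ₀‖ ≤ C * √(n * Real.log d)) :
    ∃ q, 0 < q ∧ ψ (lossLevel C d F xbar ε L) = q * sigmaF φ F u Θ ∧
      C ^ 2 / 8 * n ≤ q ^ 2 ∧ C' * n * q ^ 4 ≤ k := by
  have h6 := sigmaF_mul_le_two_mul hC.le hF hL hL' hmin hzero hKL hr hθ₀ hJ hx
  revert h6 hk
  generalize sigmaF φ F u Θ = σ at *
  generalize ψ (lossLevel C d F xbar ε L) = Ψ at *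
  intro hk h6
  have hn' : (0 : ℝ) < n := by exact_mod_cast hn
  have h7 : C * √(n * Real.log d) / 2 ≤ Ψ / σ := by
    rw [le_div_iff₀ hσ]
    linarith
  have h8 : 0 < C * √(n * Real.log d) / 2 := by
    have : 0 < √(n * Real.log d) := Real.sqrt_pos.2 (mul_pos hn' (by linarith))
    positivity
  refine ⟨Ψ / σ, h8.trans_le h7, by field_simp, ?_, ?_⟩
  -- The `8` combines the square of the factor `1/2` in `h7` with `log d ≥ 1/2`.
  · calc C ^ 2 / 8 * n ≤ C ^ 2 * (n * Real.log d) / 4 := by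
          have : (0 : ℝ) ≤ C ^ 2 * n := by positivity
          nlinarith
      _ = (C * √(n * Real.log d) / 2) ^ 2 := by
          rw [div_pow, mul_pow, Real.sq_sqrt (mul_nonneg hn'.le (by linarith))]
          ring
      _ ≤ (Ψ / σ) ^ 2 := by gcongr
  · refine le_trans (le_of_eq ?_) hk
    rw [div_pow]
    field_simp

/-- The initialization condition from a lower bound on the singular value and on the width. -/
theorem initCondition_of_le (hφ : ContDiff ℝ 1 φ) {B : ℝ≥0}
    (hB : ∀ x, |deriv φ x| ≤ B) (hlip : LipschitzWith B (deriv φ)) (hu : ‖u‖ = 1)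
    {s M q : ℝ} (hs : 0 < s) (hσ : s ≤ sigmaMinJac φ u θ₀) (hM : 0 ≤ M)
    (hθ₀ : ∀ j, ‖outCol j θ₀‖ ≤ M) (hq : 0 < q) (hσF : 0 < sigmaF φ F u Θ)
    (hψ : ψ (L (F (net φ u θ₀))) ≤ q * sigmaF φ F u Θ)
    (hρ : 2 * (4 * q / s) * (B * (2 + (M + 4 * q / s)) / √(k : ℝ)) ≤ s) :
    InitCondition φ F L ψ u Θ θ₀ := by
  have hσ0 := hs.trans_le hσ
  refine ⟨hσ0, ?_⟩
  -- Twice the upper bound `2q/s` for `R'`, which makes the final inequality strict.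
  set ρ : ℝ≥0 := ⟨4 * q / s, by positivity⟩ with hρd
  have hρc : (ρ : ℝ) = 4 * q / s := rfl
  have hR : (ρ : ℝ≥0∞) ≤ radiusR φ u θ₀ :=
    le_radiusR hφ hB hlip hu hM hθ₀ (by rw [hρc]; exact hρ.trans hσ)
  refine lt_of_lt_of_le ?_ hR
  rw [← ENNReal.ofReal_coe_nnreal, hρc, ENNReal.ofReal_lt_ofReal_iff (by positivity)]
  calc radiusR' φ F L ψ u Θ θ₀
      ≤ 2 / (sigmaF φ F u Θ * sigmaMinJac φ u θ₀) * (q * sigmaF φ F u Θ) := by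
        unfold radiusR'
        gcongr
    _ = 2 * q / sigmaMinJac φ u θ₀ := by field_simp
    _ ≤ 2 * q / s := by gcongr
    _ < 4 * q / s := by gcongr; norm_num

end Deterministic

/-! ### Assembly of the events and of the constants -/

/-- A null set and finitely many bad events leave a measurable good event. -/
theorem exists_measurableSet_of_measure_compl_le {Ω : Type*} [MeasurableSpace Ω] {μ : Measure Ω}
    [IsProbabilityMeasure μ] {G : Set Ω} {δ : ℝ} (hδ : 0 ≤ δ) (h : μ Gᶜ ≤ ENNReal.ofReal δ) :
    ∃ E, MeasurableSet E ∧ 1 - δ ≤ μ.real E ∧ E ⊆ G := by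
  -- `G` itself need not be measurable, so its complement is replaced by a measurable hull of the
  -- same measure.
  refine ⟨(toMeasurable μ Gᶜ)ᶜ, (measurableSet_toMeasurable _ _).compl, ?_, ?_⟩
  · rw [probReal_compl_eq_one_sub (measurableSet_toMeasurable _ _), measureReal_def,
      measure_toMeasurable]
    have := ENNReal.toReal_le_of_le_ofReal hδ h
    linarith
  · exact compl_subset_comm.1 (subset_toMeasurable _ _)

theorem two_mul_exp_neg_two_mul_log_le {d : ℕ} (hd : 2 ≤ d) :
    2 * Real.exp (-(2 * Real.log d)) ≤ 1 / (d : ℝ) := by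
  have hd' : (2 : ℝ) ≤ d := by exact_mod_cast hd
  have hd0 : (0 : ℝ) < d := by linarith
  have : Real.exp (-(2 * Real.log d)) = 1 / (d : ℝ) ^ 2 := by
    rw [Real.exp_neg, two_mul, Real.exp_add, Real.exp_log hd0, sq, one_div]
  rw [this, mul_one_div, div_le_div_iff₀ (by positivity) hd0]
  nlinarith

theorem half_le_log {d : ℕ} (hd : 2 ≤ d) : 1 / 2 ≤ Real.log d := by
  have h1 := Real.log_le_log (by norm_num) (show (2 : ℝ) ≤ d by exact_mod_cast hd)
  have h2 := Real.log_two_gt_d9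
  linarith

namespace RandomInit

variable {Ω : Type*} [MeasurableSpace Ω] {μ : Measure Ω} [IsProbabilityMeasure μ] {D : ℝ}
  {k d n : ℕ} {u : Ω → Vec d} {W : Ω → Matrix (Fin k) (Fin d) ℝ}
  {V : Ω → Matrix (Fin n) (Fin k) ℝ} {φ : ℝ → ℝ}

/-- The network output is of order `√(n log d)` unless the activations are large. -/
theorem measure_norm_net_le (h : RandomInit μ D u W V) (hφ : Continuous φ) (hn : 0 < n)
    (hd : 2 ≤ d) {D' : ℝ} (hD' : 0 < D') (hD : D ≤ D') {p : ℝ} (hp : 0 < p) :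
    μ {ω | meanSqAct φ (u ω) (W ω) ≤ 4 * p ∧
      4 * D' * √p * √(n * Real.log d) ≤ ‖net φ (u ω) (mkParam (W ω) (V ω))‖} ≤
      ENNReal.ofReal (1 / d) := by
  have hlog := half_le_log hd
  -- With `P = 4p`, this `t` makes the exponent exactly `-2 log d`, and `2 / d² ≤ 1 / d` for `d ≥
  -- 2`.
  have hb := h.measure_outNorm_le hφ hn hD' hD (P := 4 * p) (by positivity)
    (t := 4 * D' * √p * √(Real.log d)) (by positivity)
  have hexp : -(4 * D' * √p * √(Real.log d)) ^ 2 / (2 * (4 * p * D' ^ 2)) =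
      -(2 * Real.log d) := by
    rw [mul_pow, Real.sq_sqrt (by linarith), mul_pow, Real.sq_sqrt hp.le]
    field_simp
    ring
  rw [hexp] at hb
  refine le_trans (measure_mono fun ω hω => ?_)
    (hb.trans (ENNReal.ofReal_le_ofReal (two_mul_exp_neg_two_mul_log_le hd)))
  refine ⟨hω.1, ?_⟩
  rw [← norm_net_mkParam, mul_left_comm, ← Real.sqrt_mul (Nat.cast_nonneg n)]
  exact hω.2

/-- With positive probability the network output is of order `√(n log d)`. -/
theorem exists_norm_net_le (h : RandomInit μ D u W V) (hφ : SmoothActivation φ) (hφ0 : φ ≠ 0)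
    (hn : 0 < n) (hd : 2 ≤ d) (hk : 0 < k) {D' : ℝ} (hD' : 0 < D') (hD : D ≤ D')
    {Q : Ω → Prop} (hQ : ∀ᵐ ω ∂μ, Q ω) :
    ∃ ω, Q ω ∧ ‖net φ (u ω) (mkParam (W ω) (V ω))‖ ≤
      4 * D' * √(actMoment φ) * √(n * Real.log d) := by
  by_contra! hcon
  have hae : ∀ᵐ ω ∂μ, ω ∈ (univ : Set Ω) →
      ω ∈ {ω | 4 * actMoment φ ≤ meanSqAct φ (u ω) (W ω)} ∪
        {ω | meanSqAct φ (u ω) (W ω) ≤ 4 * actMoment φ ∧ 4 * D' * √(actMoment φ) *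
          √(n * Real.log d) ≤ ‖net φ (u ω) (mkParam (W ω) (V ω))‖} := by
    filter_upwards [hQ] with ω h1 _
    rcases le_total (4 * actMoment φ) (meanSqAct φ (u ω) (W ω)) with h | h
    · exact Or.inl h
    · exact Or.inr ⟨h, (hcon ω h1).le⟩
  -- If no outcome were good, two events of probability at most `1/4` and `1/d ≤ 1/2` would cover
  -- almost everything.
  have h1 : (1 : ℝ≥0∞) ≤ ENNReal.ofReal (1 / 4) + ENNReal.ofReal (1 / d) := by
    rw [← measure_univ (μ := μ)]
    exact (measure_mono_ae hae).trans ((measure_union_le _ _).trans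
      (add_le_add (h.measure_meanSqAct_large_le hφ hφ0 hk)
        (h.measure_norm_net_le hφ.1.continuous hn hd hD' hD (actMoment_pos hφ hφ0))))
  rw [← ENNReal.ofReal_add (by norm_num) (by positivity), ENNReal.one_le_ofReal] at h1
  have hd2' : (2 : ℝ) ≤ d := by exact_mod_cast hd
  have : 1 / (d : ℝ) ≤ 1 / 2 := by gcongr
  linarith

end RandomInit

/-- The probability in Chebyshev's inequality for wide networks. -/
theorem four_mul_div_le_two_div {v p c C' n k : ℝ} (hp : 0 < p) (hc : 0 < c)
    (hn : 0 < n) (hk : 0 < k) (hC' : 2 * v / (p ^ 2 * c ^ 2) ≤ C') (hkn : C' * c ^ 2 * n ≤ k) :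
    4 * v / (k * p ^ 2) ≤ 2 / n := by
  have h1 : 2 * v / (p ^ 2 * c ^ 2) * c ^ 2 * n ≤ k := le_trans (by gcongr) hkn
  have h2 : 2 * v / (p ^ 2 * c ^ 2) * c ^ 2 * n * (2 * p ^ 2) = 4 * v * n := by
    field_simp
    ring
  rw [div_le_div_iff₀ (by positivity) hn, ← h2]
  nlinarith [pow_pos hp 2]

theorem mainTheorem2 (φ : ℝ → ℝ) (hφ : SmoothActivation φ) (hφ0 : φ ≠ 0) (D : ℝ) :
    ∃ C C' : ℝ, 0 < C ∧ 0 < C' ∧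
      ∀ (n m d k : ℕ), 0 < n → 0 < d → 0 < k →
      ∀ (F : Vec n → Vec m), ContDiff ℝ 1 F → LipschitzOnBounded (fderiv ℝ F) → F 0 = 0 →
      ∀ (xbar : Vec n) (ε : Vec m) (L : Vec m → ℝ),
        ContDiff ℝ 1 L → LipschitzOnBounded (gradient L) →
        IsLeast (Set.range L) 0 → (∀ v, L v = 0 ↔ v = F xbar + ε) →
      ∀ (ψ : ℝ → ℝ) (r₀ : ℝ), KLInequality L ψ r₀ → lossLevel C d F xbar ε L < r₀ →
      ∀ (Ω : Type*) [MeasurableSpace Ω] (μ : Measure Ω) [IsProbabilityMeasure μ]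
        (u : Ω → Vec d) (W : Ω → Matrix (Fin k) (Fin d) ℝ) (V : Ω → Matrix (Fin n) (Fin k) ℝ),
        RandomInit μ D u W V →
      ∀ (Θ : Ω → Set (Param k d n)),
        (∀ᵐ ω ∂μ, mkParam (W ω) (V ω) ∈ Θ ω ∧
          fderiv ℝ F (net φ (u ω) (mkParam (W ω) (V ω))) ≠ 0 ∧
          0 < sigmaF φ F (u ω) (Θ ω)) →
        (∀ᵐ ω ∂μ, C' * (sigmaF φ F (u ω) (Θ ω) ^ 4)⁻¹ * n *
          ψ (lossLevel C d F xbar ε L) ^ 4 ≤ k) →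
      ∃ E : Set Ω, MeasurableSet E ∧ 1 - 2 / (n : ℝ) - 1 / (d : ℝ) ≤ μ.real E ∧
        ∀ ω ∈ E, L (F (net φ (u ω) (mkParam (W ω) (V ω)))) < r₀ ∧
          InitCondition φ F L ψ (u ω) (Θ ω) (mkParam (W ω) (V ω)) := by
  obtain ⟨hφ1, B, -, hB, hlip⟩ := id hφ
  obtain ⟨p, hpd⟩ : ∃ p, p = actMoment φ := ⟨_, rfl⟩
  have hp : 0 < p := hpd ▸ actMoment_pos hφ hφ0
  have hv : 0 ≤ actVar φ := variance_nonneg _ _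
  -- `D` is an arbitrary real, so it is replaced by a positive bound.
  obtain ⟨D₁, hD₁0, hDD₁⟩ : ∃ D₁ : ℝ, 0 < D₁ ∧ D ≤ D₁ :=
    ⟨|D| + 1, by positivity, (le_abs_self D).trans (by linarith)⟩
  obtain ⟨C, hCd⟩ : ∃ C, C = 4 * D₁ * √p := ⟨_, rfl⟩
  have hC0 : 0 < C := hCd ▸ by positivity
  obtain ⟨c, hcd⟩ : ∃ c, c = C ^ 2 / 8 := ⟨_, rfl⟩
  have hc0 : 0 < c := hcd ▸ by positivity
  obtain ⟨s, hsd⟩ : ∃ s, s = √(p / 2) := ⟨_, rfl⟩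
  have hs0 : 0 < s := hsd ▸ Real.sqrt_pos.2 (by positivity)
  obtain ⟨K, hKd⟩ : ∃ K, K = 8 * B / s ^ 2 * ((2 + D₁) / √c + 4 / s) := ⟨_, rfl⟩
  -- `C'` serves two purposes: the Chebyshev failure is at most `2/n`, and the width exceeds `K² n
  -- q⁴`.
  obtain ⟨C', hC'0, hC'v, hC'K⟩ : ∃ C' : ℝ, 0 < C' ∧ 2 * actVar φ / (p ^ 2 * c ^ 2) ≤ C' ∧
      K ^ 2 ≤ C' := by
    have h1 : 0 ≤ 2 * actVar φ / (p ^ 2 * c ^ 2) := by positivity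
    have h2 := sq_nonneg K
    exact ⟨K ^ 2 + 2 * actVar φ / (p ^ 2 * c ^ 2) + 1, by positivity, by linarith, by linarith⟩
  refine ⟨C, C', hC0, hC'0, ?_⟩
  intro n m d k hn hd hk F hF _ hF0 xbar ε L hL hL' hmin hzero ψ r₀ hKL hr Ω _ μ _ u W V hinit Θ
    hΘ hwidth
  -- A nonpositive probability bound is met by the empty event. This disposes of `d = 1`, where `log
  -- d = 0` gives no control.
  rcases le_or_gt (1 - 2 / (n : ℝ) - 1 / (d : ℝ)) 0 with htriv | hpos
  · exact ⟨∅, MeasurableSet.empty, by simpa using htriv, by simp⟩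
  have hn' : (1 : ℝ) ≤ n := by exact_mod_cast hn
  have hk' : (0 : ℝ) < k := by exact_mod_cast hk
  have hd2 : 2 ≤ d := by
    by_contra! h
    obtain rfl : d = 1 := by omega
    have : 0 ≤ 2 / (n : ℝ) := by positivity
    norm_num at hpos
    linarith
  have hout := hinit.measure_norm_net_le hφ1.continuous hn hd2 hD₁0 hDD₁ hp
  rw [← hCd] at hout
  -- Chebyshev needs a lower bound on `k` free of `ω`. One outcome with a moderate output suffices,
  -- since there `q² ≥ c n ≥ c`.
  have hkn : C' * c ^ 2 * n ≤ k := by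
    obtain ⟨ω, ⟨⟨hω1, hω2, hω3⟩, hω4⟩, hω5⟩ :=
      hinit.exists_norm_net_le hφ hφ0 hn hd2 hk hD₁0 hDD₁ (hΘ.and hwidth)
    rw [← hpd, ← hCd] at hω5
    obtain ⟨q, hq, -, hq2, hqk⟩ := exists_ratio_bounds hC0 hn (half_le_log hd2) hF hL hL' hmin
      hzero hKL hr hω1 hω2 hω3 hω4 hω5
    rw [← hcd] at hq2
    refine le_trans ?_ hqk
    calc C' * c ^ 2 * n = C' * n * (c * 1) ^ 2 := by ring
      _ ≤ C' * n * (q ^ 2) ^ 2 := by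
          gcongr
          exact (mul_le_mul_of_nonneg_left hn' hc0.le).trans hq2
      _ = C' * n * q ^ 4 := by ring
  have hfar := (hinit.measure_meanSqAct_far_le hφ hφ0 hk).trans (ENNReal.ofReal_le_ofReal
    (four_mul_div_le_two_div (hpd ▸ hp) hc0 (by linarith) hk' (hpd ▸ hC'v) hkn))
  rw [← hpd] at hfar
  obtain ⟨E, hE, hE1, hEG⟩ := exists_measurableSet_of_measure_compl_le (μ := μ)
    (G := {ω | L (F (net φ (u ω) (mkParam (W ω) (V ω)))) < r₀ ∧
      InitCondition φ F L ψ (u ω) (Θ ω) (mkParam (W ω) (V ω))}) (δ := 2 / n + 1 / d)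
    (by positivity) (by
      rw [ENNReal.ofReal_add (by positivity) (by positivity)]
      refine le_trans ?_ ((measure_union_le _ _).trans (add_le_add hfar hout))
      refine measure_mono_ae ?_
      -- Up to a null set, an outcome avoiding both the Chebyshev event and the large-output event
      -- satisfies the conclusion.
      filter_upwards [hΘ, hwidth, hinit.norm_u, hinit.V_bound] with ω hω hk4 hu hV
      intro hbad
      by_contra hnot
      have hn1 : ¬ p / 2 ≤ |meanSqAct φ (u ω) (W ω) - p| := fun h => hnot (Or.inl h)
      refine hbad ?_
      have hΦ := abs_lt.1 (not_le.1 hn1)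
      have hΦ4 : meanSqAct φ (u ω) (W ω) ≤ 4 * p := by linarith
      have hnet : ‖net φ (u ω) (mkParam (W ω) (V ω))‖ ≤ C * √(n * Real.log d) := by
        by_contra! h
        exact hnot (Or.inr ⟨hΦ4, h.le⟩)
      obtain ⟨q, hq, hψq, hq2, hqk⟩ := exists_ratio_bounds hC0 hn (half_le_log hd2) hF hL hL'
        hmin hzero hKL hr hω.1 hω.2.1 hω.2.2 hk4 hnet
      rw [← hcd] at hq2
      have hLle := loss_le_lossLevel (ε := ε) (xbar := xbar) hC0.le hF hF0 hL hL' hmin hzero hnet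
      refine ⟨hLle.trans_lt hr, ?_⟩
      have h0 : 0 ≤ L (F (net φ (u ω) (mkParam (W ω) (V ω)))) := hmin.2 ⟨_, rfl⟩
      have hψle := hKL.strictMono.monotoneOn ⟨h0, hLle.trans_lt hr⟩ ⟨h0.trans hLle, hr⟩ hLle
      have hσs : s ≤ sigmaMinJac φ (u ω) (mkParam (W ω) (V ω)) := by
        rw [hsd]
        refine le_trans (Real.sqrt_le_sqrt ?_) (sqrt_meanSqAct_le_sigmaMinJac hφ1 hn _ _ _)
        linarith
      refine initCondition_of_le hφ1 hB hlip hu hs0 hσs (M := D₁ * √n) (by positivity)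
        (norm_outCol_mkParam_le _ (fun i j => (hV i j).trans hDD₁) hD₁0.le) hq hω.2.2
        (hψle.trans hψq.le) ?_
      refine width_suffices hs0 B.2 hD₁0.le hc0 hq hn' hq2 hKd hk' (le_trans ?_ hqk)
      gcongr)
  exact ⟨E, hE, by linarith, fun ω hω => hEG hω⟩
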